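/- **General solvability theorem for synchronous Byzantine agreement.** Let $n$ and $t$ be integers with $0\le t<n$, and let $\mathcal V_I\neq\emptyset$ and $\mathcal V_O$ be (possibly infinite) effectively encoded countable sets of proposals and decisions. An *input configuration* $c$ assigns a proposal in $\mathcal V_I$ to every process of a set $\pi(c)\subseteq\{p_1,\dots,p_n\}$ with $|\pi(c)|\ge n-t$ (the correct processes); $\mathcal I$ is the set of input configurations. Write $c_1\sqsupseteq c_2$ ($c_1$ *contains* $c_2$) if $\pi(c_1)\supseteq\pi(c_2)$ and each process in $\pi(c_2)$ has the same proposal in $c_1$ and $c_2$. A *Byzantine agreement problem* $\mathcal P$ is given by a validity property $\mathit{val}:\mathcal I\to 2^{\mathcal V_O}\setminus\{\emptyset\}$. It is *trivial* if some $v'\in\mathcal V_O$ lies in $\mathit{val}(c)$ for all $c\in\mathcal I$. It satisfies the *containment condition* if there is a Turing-computable $\Gamma:\mathcal I\to\mathcal V_O$ with $$\Gamma(c)\in\bigcap_{c'\in\mathcal I,\ c\sqsupseteq c'}\mathit{val}(c')\qquad\text{for all }c\in\mathcal I .$$ Processes are deterministic state machines with Turing-computable transitions. They exchange messages in synchronous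 rounds, the receiver of a message knows its sender, and the at most $t$ faulty processes may send arbitrary messages. An algorithm *solves* $\mathcal P$ if in every execution every correct process eventually decides, no two correct processes decide differently, and correct processes decide only values in $\mathit{val}(c)$, where $c$ is the input configuration of the execution. $\mathcal P$ is *unauthenticated-solvable* if such an algorithm exists without any signature mechanism, and *authenticated-solvable* if such an algorithm exists when processes can sign contents with idealized signatures that nobody else can forge: a process can send, besides its own signatures, only signatures of others that it has received. Faulty processes may pool their own signatures and all signatures they have received, including those sent to them by correct processes in the current round. Then every non-trivial Byzantine agreement problem $\mathcal P$ is 1. authenticated-solvable if and only if it satisfies the containment condition; and 2. provided $(n,t)\neq(2,1)$, unauthenticated-solvable if and only if it satisfies the containment condition and $n>3t$. -/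

import Mathlib

/-! Synchronous Byzantine agreement: problems, algorithms, executions, solvability. -/

/-- An input configuration of a system of `n` processes of which at most `t` are faulty: an
assignment of proposals to the correct processes. `c.1 i = some v` says that process `i` is correct
and proposes `v`; `c.1 i = none` says that `i` is faulty. At least `n - t` processes are correct. -/
def InputConfig (n t : ℕ) (VI : Type) : Type :=
  {c : Fin n → Option VI // n ≤ (Finset.univ.filter fun i => (c i).isSome).card + t}

theorem InputConfig.primrecPred (n t : ℕ) (VI : Type) [Primcodable VI] :
    PrimrecPred fun c : Fin n → Option VI =>
      n ≤ (Finset.univ.filter fun i => (c i).isSome).card + t := by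
  have hg : ∀ i : Fin n, Primrec fun c : Fin n → Option VI =>
      if (c i).isSome = true then 1 else 0 := by
    intro i
    have h1 : Primrec fun c : Fin n → Option VI => (c i).isSome :=
      Primrec.option_isSome.comp (Primrec.fin_app.comp Primrec.id (Primrec.const i))
    exact Primrec.ite (Primrec.eq.comp h1 (Primrec.const true)) (Primrec.const 1) (Primrec.const 0)
  have hs : ∀ s : Finset (Fin n), Primrec fun c : Fin n → Option VI =>
      ∑ i ∈ s, if (c i).isSome = true then 1 else 0 := by
    intro s
    induction s using Finset.induction_on with
    | empty => simpa using Primrec.const 0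
    | insert a s ha ih =>
      simp only [Finset.sum_insert ha]
      exact Primrec.nat_add.comp (hg a) ih
  have hc : Primrec fun c : Fin n → Option VI =>
      (Finset.univ.filter fun i => (c i).isSome).card + t := by
    simp only [Finset.card_filter]
    exact Primrec.nat_add.comp (hs Finset.univ) (Primrec.const t)
  exact Primrec.nat_le.comp (Primrec.const n) hc

instance InputConfig.primcodable (n t : ℕ) (VI : Type) [Primcodable VI] :
    Primcodable (InputConfig n t VI) :=
  Primcodable.subtype (InputConfig.primrecPred n t VI)

namespace InputConfig

variable {n t : ℕ} {VI : Type}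

/-- Process `i` is correct according to `c`. -/
def Correct (c : InputConfig n t VI) (i : Fin n) : Prop := c.1 i ≠ none

/-- Process `i` is faulty according to `c`. -/
def Faulty (c : InputConfig n t VI) (i : Fin n) : Prop := c.1 i = none

/-- The containment relation: every process that is correct according to `c₂` is correct according
to `c₁`, with the same proposal. -/
def Contains (c₁ c₂ : InputConfig n t VI) : Prop :=
  (∀ i, c₂.Correct i → c₁.Correct i) ∧ ∀ i, c₂.Correct i → c₁.1 i = c₂.1 i

end InputConfig

/-- A validity property: it maps every input configuration to a non-empty set of admissible
decisions. It determines one Byzantine agreement problem. -/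
structure ValidityProperty (n t : ℕ) (VI VO : Type) where
  admissible : InputConfig n t VI → Set VO
  nonempty : ∀ c, (admissible c).Nonempty

/-- The problem is trivial: some value is admissible according to every input configuration. -/
def ValidityProperty.Trivial {n t : ℕ} {VI VO : Type} (val : ValidityProperty n t VI VO) : Prop :=
  ∃ v : VO, ∀ c, v ∈ val.admissible c

/-- The containment condition. -/
def ValidityProperty.ContainmentCondition {n t : ℕ} {VI VO : Type} [Primcodable VI]
    [Primcodable VO] (val : ValidityProperty n t VI VO) : Prop :=
  ∃ Γ : InputConfig n t VI → VO, Computable Γ ∧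
    ∀ c c' : InputConfig n t VI, c.Contains c' → Γ c ∈ val.admissible c'

/-- An algorithm for `n` processes with messages in `Msg`: every process is a deterministic state
machine whose functions are Turing-computable. `send i s j` is the message (if any) that process
`i`, in state `s` at the start of a round, sends to process `j` in that round; `trans i s rcv` is
the next state of `i` if the message it received from `j` in the round is `rcv j`; `decision i s`
is the decision (if any) that `i` has made by state `s`. Decisions are irrevocable. -/
structure Machine (n : ℕ) (VI VO Msg : Type) [Primcodable VI] [Primcodable VO]
    [Primcodable Msg] where
  State : Type
  [primcodableState : Primcodable State]
  init : Fin n → VI → State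
  send : Fin n → State → Fin n → Option Msg
  trans : Fin n → State → (Fin n → Option Msg) → State
  decision : Fin n → State → Option VO
  decision_stable : ∀ i s rcv v, decision i s = some v → decision i (trans i s rcv) = some v
  computable_init : ∀ i, Computable (init i)
  computable_send : ∀ i, Computable (send i)
  computable_trans : ∀ i, Computable₂ (trans i)
  computable_decision : ∀ i, Computable (decision i)

attribute [instance] Machine.primcodableState

/-- What identifies an (infinite) execution of an algorithm: its input configuration (the correct
processes and their proposals; all other processes are faulty), and the message (if any)
`byz r k i` that each faulty process `k` sends to each process `i` in each round `r`. The values of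
`byz` at correct senders play no role. -/
structure Execution (n t : ℕ) (VI Msg : Type) where
  input : InputConfig n t VI
  byz : ℕ → Fin n → Fin n → Option Msg

namespace Machine

variable {n t : ℕ} {VI VO Msg : Type} [Primcodable VI] [Primcodable VO] [Primcodable Msg]

/-- The message sent from `j` to `i` in round `r`, where `σ` gives the states of the correct
processes at the start of round `r`. A process sends no messages to itself. -/
def sentFrom (A : Machine n VI VO Msg) (E : Execution n t VI Msg) (σ : Fin n → Option A.State)
    (r : ℕ) (j i : Fin n) : Option Msg :=
  if j = i then none
  else match σ j with
    | some s => A.send j s i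
    | none => E.byz r j i

/-- The states of the correct processes at the start of each round (`none` for faulty processes).
Rounds are numbered from `0`. -/
def state (A : Machine n VI VO Msg) (E : Execution n t VI Msg) : ℕ → Fin n → Option A.State
  | 0 => fun i => (E.input.1 i).map (A.init i)
  | r + 1 => fun i => (A.state E r i).map fun s =>
      A.trans i s fun j => A.sentFrom E (A.state E r) r j i

/-- The message sent from `j` to `i` in round `r` of the execution; it is received in round `r`. -/
def sent (A : Machine n VI VO Msg) (E : Execution n t VI Msg) (r : ℕ) (j i : Fin n) : Option Msg :=
  A.sentFrom E (A.state E r) r j i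

/-- The correct process `i` decides `v` in the execution. -/
def Decides (A : Machine n VI VO Msg) (E : Execution n t VI Msg) (i : Fin n) (v : VO) : Prop :=
  ∃ r s, A.state E r i = some s ∧ A.decision i s = some v

/-- Termination, Agreement and validity hold in the execution. -/
def SolvesIn (A : Machine n VI VO Msg) (val : ValidityProperty n t VI VO)
    (E : Execution n t VI Msg) : Prop :=
  (∀ i, E.input.Correct i → ∃ v, A.Decides E i v) ∧
  (∀ i j v w, E.input.Correct i → E.input.Correct j →
    A.Decides E i v → A.Decides E j w → v = w) ∧
  (∀ i v, E.input.Correct i → A.Decides E i v → v ∈ val.admissible E.input)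

/-- The state of process `i` at the start of each round if it proposes `v` and the message it
receives from `j` in round `r` is `rcv r j`. -/
def localState (A : Machine n VI VO Msg) (i : Fin n) (v : VI) (rcv : ℕ → Fin n → Option Msg) :
    ℕ → A.State
  | 0 => A.init i v
  | r + 1 => A.trans i (A.localState i v rcv r) (rcv r)

end Machine

/-- An unauthenticated algorithm uses messages from any effectively encoded set, and faulty
processes may send any messages whatsoever. -/
def UnauthSolvable {n t : ℕ} {VI VO : Type} [Primcodable VI] [Primcodable VO]
    (val : ValidityProperty n t VI VO) : Prop :=
  ∃ (Msg : Type) (_ : Primcodable Msg) (A : Machine n VI VO Msg),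
    ∀ E : Execution n t VI Msg, A.SolvesIn val E

/-- An idealized signature `(i, d)`: the signature of process `i` on the content `d`. -/
abbrev Signature (n : ℕ) (D : Type) : Type := Fin n × D

/-- A message of an authenticated algorithm: a payload together with (valid) signatures. -/
abbrev SignedMsg (n : ℕ) (D : Type) : Type := D × List (Signature n D)

/-- The algorithm never instructs a process to forge: a process attaches only its own signatures
and signatures that it has received in earlier rounds. -/
def Machine.RespectsSignatures {n : ℕ} {VI VO D : Type} [Primcodable VI] [Primcodable VO]
    [Primcodable D] (A : Machine n VI VO (SignedMsg n D)) : Prop :=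
  ∀ (i : Fin n) (v : VI) (rcv : ℕ → Fin n → Option (SignedMsg n D)) (r : ℕ) (k : Fin n),
    ∀ m ∈ A.send i (A.localState i v rcv r) k, ∀ sg ∈ m.2,
      sg.1 = i ∨ ∃ r' < r, ∃ j, ∃ m' ∈ rcv r' j, sg ∈ m'.2

/-- The faulty processes forge no signature of a correct process: every signature that a faulty
process `k` attaches in round `r` is a signature of a faulty process or occurs in a message that a
correct process sent to a faulty process in some round up to (and including) round `r`. -/
def Machine.Unforged {n t : ℕ} {VI VO D : Type} [Primcodable VI] [Primcodable VO] [Primcodable D]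
    (A : Machine n VI VO (SignedMsg n D)) (E : Execution n t VI (SignedMsg n D)) : Prop :=
  ∀ (r : ℕ) (k i : Fin n), E.input.Faulty k → ∀ m ∈ E.byz r k i, ∀ sg ∈ m.2,
    E.input.Faulty sg.1 ∨
      ∃ r' ≤ r, ∃ j k', E.input.Correct j ∧ E.input.Faulty k' ∧
        ∃ m' ∈ A.sent E r' j k', sg ∈ m'.2

/-- An authenticated algorithm may use signatures, which nobody can forge. -/
def AuthSolvable {n t : ℕ} {VI VO : Type} [Primcodable VI] [Primcodable VO]
    (val : ValidityProperty n t VI VO) : Prop :=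
  ∃ (D : Type) (_ : Primcodable D) (A : Machine n VI VO (SignedMsg n D)),
    A.RespectsSignatures ∧
      ∀ E : Execution n t VI (SignedMsg n D), A.Unforged E → A.SolvesIn val E

/-!
Every algorithm that solves the problem yields a witness of the containment condition: let `Γ c` be
the decision of the correct processes when the input configuration is `c` and the faulty processes
are silent. If `c` contains `c'`, the processes that are correct according to `c'` cannot tell this
execution from one with input configuration `c'` in which some faulty processes pretend to be
correct, so `Γ c` is admissible for `c'` (`Machine.state_shadow`). Pretending to be correct needs no
forged signatures (`Machine.unforged_shadow`), and `Γ` is computed by simulation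
(`Machine.exists_computable_decision`).

Conversely, the containment condition reduces the problem to letting all correct processes agree on
one vector of proposals that has the right entries at the correct processes. Such a vector is an
input configuration that contains the actual one (`InputConfig.exists_contains`), so `Γ` of it is an
admissible decision. With signatures and any `t < n`, the vector is obtained by `n` parallel
Dolev–Strong broadcasts over `t + 1` rounds (`authSolvable_of_containment`). Without signatures and
with `3 * t < n`, every process sends its proposal to all, and then `n` parallel instances of the
phase king algorithm make the received vectors equal; they preserve an entry on which the correct
processes already agree, and `t + 1` phases include one with a correct king (`phase_king`,
`unauthSolvable_of_lt`).

If `n ≤ 3 * t`, split the processes into three blocks of at most `t` processes and lay out copies of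
the blocks periodically on an infinite line. Two adjacent blocks of the line cannot tell it from an
execution in which the third block is faulty and simulates the rest of the line, so adjacent blocks
make the same decision, and hence all blocks do. If the proposals on the left and on the right half
of the line come from two input configurations without faulty processes, then far blocks behave as
in the respective fault-free executions. So all fault-free executions lead to the same decision
(`Machine.decision_full_eq`). Every input configuration is contained in one without faulty
processes, so that decision is admissible for all of them and the problem is trivial
(`lt_of_unauthSolvable`).
-/

/-! ### Computability on finite products -/

section Computability

variable {α β σ : Type*} [Primcodable α] [Primcodable β] [Primcodable σ] {n : ℕ}

theorem Primrec.fin_pi {f : α → Fin n → σ} (h : ∀ i, Primrec fun a => f a i) : Primrec f := by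
  have h1 : Primrec₂ fun (i : Fin n) (a : α) => f a i := Primrec.fin_curry₁.2 h
  exact Primrec.fin_curry.2 h1.swap

theorem Primrec.fin_eval {f : α → Fin n → σ} (h : Primrec f) (i : Fin n) :
    Primrec fun a => f a i :=
  Primrec.fin_app.comp h (Primrec.const i)

theorem Computable.fin_pi {f : α → Fin n → σ} (h : ∀ i, Computable fun a => f a i) :
    Computable f := by
  have h1 : Computable fun a => List.Vector.ofFn (f a) :=
    Computable.vector_ofFn (f := fun i a => f a i) h
  have h2 : Primrec fun v : List.Vector σ n => v.get :=
    Primrec.fin_pi fun i => Primrec.vector_get.comp Primrec.id (Primrec.const i)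
  refine (h2.to_comp.comp h1).of_eq fun a => ?_
  funext i
  simp

theorem Computable.fin_eval {f : α → Fin n → σ} (h : Computable f) (i : Fin n) :
    Computable fun a => f a i :=
  Computable.fin_app.comp h (Computable.const i)

theorem Primrec.findSome_fin {f : α → Fin n → Option σ} (h : ∀ i, Primrec fun a => f a i)
    (l : List (Fin n)) : Primrec fun a => l.findSome? (f a) := by
  induction l with
  | nil => simpa using Primrec.const none
  | cons i l ih =>
    refine (Primrec.option_orElse.comp (h i) ih).of_eq fun a => ?_
    cases h : f a i <;> simp [h]

theorem Computable.findSome_fin {f : α → Fin n → Option σ} (h : ∀ i, Computable fun a => f a i)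
    (l : List (Fin n)) : Computable fun a => l.findSome? (f a) := by
  induction l with
  | nil => simpa using Computable.const none
  | cons i l ih =>
    refine (Primrec.option_orElse.to_comp.comp (h i) ih).of_eq fun a => ?_
    cases h : f a i <;> simp [h]

theorem Primrec.card_filter_fin {p : α → Fin n → Prop} [∀ a, DecidablePred (p a)]
    (h : ∀ i, PrimrecPred fun a => p a i) :
    Primrec fun a => (Finset.univ.filter (p a)).card := by
  have hs : ∀ s : Finset (Fin n), Primrec fun a => ∑ i ∈ s, if p a i then 1 else 0 := by
    intro s
    induction s using Finset.induction_on with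
    | empty => simpa using Primrec.const 0
    | insert i s hi ih =>
      simp only [Finset.sum_insert hi]
      exact Primrec.nat_add.comp (Primrec.ite (h i) (Primrec.const 1) (Primrec.const 0)) ih
  simpa only [Finset.card_filter] using hs Finset.univ

end Computability

/-! ### Solvability implies the containment condition -/

namespace InputConfig

variable {n t : ℕ} {VI : Type}

theorem correct_iff (c : InputConfig n t VI) (i : Fin n) : c.Correct i ↔ ∃ v, c.1 i = some v := by
  unfold Correct
  rw [Option.ne_none_iff_exists']

theorem Contains.refl (c : InputConfig n t VI) : c.Contains c := ⟨fun _ h => h, fun _ _ => rfl⟩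

theorem exists_correct (ht : t < n) (c : InputConfig n t VI) : ∃ i, c.Correct i := by
  by_contra! h
  have h1 : (Finset.univ.filter fun i => (c.1 i).isSome) = ∅ := by
    refine Finset.filter_eq_empty_iff.2 fun i _ => ?_
    have := h i
    unfold Correct at this
    push Not at this
    simp [this]
  have h2 := c.2
  rw [h1, Finset.card_empty] at h2
  omega

/-- The input configuration in which every process is correct. -/
def full (t : ℕ) (p : Fin n → VI) : InputConfig n t VI :=
  ⟨fun i => some (p i), by simp⟩

theorem full_correct (p : Fin n → VI) (i : Fin n) : (full t p).Correct i := by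
  simp [full, Correct]

end InputConfig

namespace Machine

variable {n t : ℕ} {VI VO Msg : Type} [Primcodable VI] [Primcodable VO] [Primcodable Msg]

/-- The execution with input configuration `c` whose faulty processes send nothing. -/
def silent (c : InputConfig n t VI) : Execution n t VI Msg := ⟨c, fun _ _ _ => none⟩

/-- The execution with input configuration `c'` whose faulty processes behave as in the execution
with input configuration `c` and silent faulty processes. If `c` contains `c'`, the processes that
are correct according to `c'` cannot distinguish the two. -/
def shadow (A : Machine n VI VO Msg) (c c' : InputConfig n t VI) : Execution n t VI Msg :=
  ⟨c', fun r k i => A.sent (silent c) r k i⟩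

theorem isSome_state (A : Machine n VI VO Msg) (E : Execution n t VI Msg) (r : ℕ) (i : Fin n) :
    (A.state E r i).isSome = (E.input.1 i).isSome := by
  induction r with
  | zero => simp [state]
  | succ r ih => simp [state, ih]

theorem exists_state (A : Machine n VI VO Msg) (E : Execution n t VI Msg) (r : ℕ) {i : Fin n}
    (h : E.input.Correct i) : ∃ s, A.state E r i = some s := by
  rw [← Option.isSome_iff_exists, isSome_state]
  exact Option.isSome_iff_ne_none.2 h

theorem state_eq_none (A : Machine n VI VO Msg) (E : Execution n t VI Msg) (r : ℕ) {i : Fin n}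
    (h : ¬ E.input.Correct i) : A.state E r i = none := by
  have h1 : E.input.1 i = none := by simpa [InputConfig.Correct] using h
  simpa [h1] using A.isSome_state E r i

theorem correct_of_state (A : Machine n VI VO Msg) (E : Execution n t VI Msg) {r : ℕ} {i : Fin n}
    {s : A.State} (h : A.state E r i = some s) : E.input.Correct i := by
  by_contra h1
  simp [state_eq_none A E r h1] at h

theorem sentFrom_of_state (A : Machine n VI VO Msg) (E : Execution n t VI Msg)
    (g : Fin n → Option A.State) (r : ℕ) {i j : Fin n} {s : A.State} (h : g j = some s)
    (hij : j ≠ i) : A.sentFrom E g r j i = A.send j s i := by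
  simp [sentFrom, h, hij]

theorem sentFrom_of_none (A : Machine n VI VO Msg) (E : Execution n t VI Msg)
    (g : Fin n → Option A.State) (r : ℕ) {i j : Fin n} (h : g j = none)
    (hij : j ≠ i) : A.sentFrom E g r j i = E.byz r j i := by
  simp [sentFrom, h, hij]

theorem sentFrom_self (A : Machine n VI VO Msg) (E : Execution n t VI Msg)
    (g : Fin n → Option A.State) (r : ℕ) (i : Fin n) : A.sentFrom E g r i i = none := by
  simp [sentFrom]

/-- The processes that are correct according to `c'` have the same states in both executions. -/
theorem state_shadow (A : Machine n VI VO Msg) {c c' : InputConfig n t VI} (h : c.Contains c')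
    (r : ℕ) {i : Fin n} (hi : c'.Correct i) :
    A.state (A.shadow c c') r i = A.state (silent c) r i := by
  induction r generalizing i with
  | zero => simp [state, shadow, silent, h.2 i hi]
  | succ r ih =>
    simp only [state]
    rw [ih hi]
    congr 1
    funext s
    congr 1
    funext j
    by_cases hij : j = i
    · subst hij
      simp [sentFrom_self]
    · by_cases hj : c'.Correct j
      · have h1 := ih hj
        obtain ⟨s', hs'⟩ := A.exists_state (silent c : Execution n t VI Msg) r (h.1 j hj)
        rw [sentFrom_of_state A _ _ r (h1.trans hs') hij, sentFrom_of_state A _ _ r hs' hij]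
      · rw [sentFrom_of_none A _ _ r (A.state_eq_none _ r hj) hij]
        rfl

theorem decides_shadow (A : Machine n VI VO Msg) {c c' : InputConfig n t VI} (h : c.Contains c')
    {i : Fin n} (hi : c'.Correct i) (v : VO) :
    A.Decides (A.shadow c c') i v ↔ A.Decides (silent c) i v := by
  simp only [Decides, state_shadow A h _ hi]

/-- One round in which the faulty processes, those without a state, send nothing. -/
def silentStep (A : Machine n VI VO Msg) (g : Fin n → Option A.State) : Fin n → Option A.State :=
  fun i => (g i).map fun s => A.trans i s fun j =>
    if j = i then none else (g j).bind fun s => A.send j s i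

theorem state_silent (A : Machine n VI VO Msg) (c : InputConfig n t VI) (r : ℕ) :
    A.state (silent c) r =
      Nat.rec (fun i => (c.1 i).map (A.init i)) (fun _ g => A.silentStep g) r := by
  induction r with
  | zero => rfl
  | succ r ih =>
    simp only [← ih]
    funext i
    simp only [state, silentStep]
    congr 1
    funext s
    congr 1
    funext j
    unfold sentFrom
    cases A.state (silent c) r j <;> rfl

theorem computable_silentStep (A : Machine n VI VO Msg) : Computable A.silentStep := by
  refine Computable.fin_pi fun i => ?_
  refine Computable.option_map (Computable.id.fin_eval i) ?_
  refine (A.computable_trans i).comp Computable.snd (Computable.fin_pi fun j => ?_)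
  by_cases h : j = i
  · simpa [h] using Computable.const none
  · simp only [h, if_false]
    refine Computable.option_bind (Computable.fst.fin_eval j) ?_
    exact ((A.computable_send j).comp Computable.snd).fin_eval i

theorem computable_state_silent (A : Machine n VI VO Msg) :
    Computable₂ fun (c : InputConfig n t VI) (r : ℕ) => A.state (silent c) r := by
  have hval : Computable fun c : InputConfig n t VI => c.1 :=
    Primrec.to_comp (@Primrec.subtype_val _ _ _ _ (InputConfig.primrecPred n t VI))
  have h1 : Computable fun p : InputConfig n t VI × ℕ => fun i => (p.1.1 i).map (A.init i) :=
    Computable.fin_pi fun i => Computable.option_map ((hval.comp Computable.fst).fin_eval i)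
      ((A.computable_init i).comp Computable.snd)
  have h2 : Computable₂ fun (_ : InputConfig n t VI × ℕ) (q : ℕ × (Fin n → Option A.State)) =>
      A.silentStep q.2 :=
    A.computable_silentStep.comp (Computable.snd.comp Computable.snd)
  exact (Computable.nat_rec Computable.snd h1 h2).of_eq fun p => (state_silent A p.1 p.2).symm

/-- A machine that solves the problem whenever the faulty processes are silent or continue such an
execution computes a witness of the containment condition: the decision reached when the faulty
processes are silent. -/
theorem exists_computable_decision (ht : t < n) (A : Machine n VI VO Msg)
    (val : ValidityProperty n t VI VO)
    (hA : ∀ c c' : InputConfig n t VI, c.Contains c' → A.SolvesIn val (A.shadow c c')) :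
    ∃ Γ : InputConfig n t VI → VO, Computable Γ ∧
      (∀ c c' : InputConfig n t VI, c.Contains c' → Γ c ∈ val.admissible c') ∧
      ∀ (c : InputConfig n t VI) i, c.Correct i → A.Decides (silent c) i (Γ c) := by
  let f : InputConfig n t VI → ℕ → Option VO := fun c r =>
    (List.finRange n).findSome? fun i => (A.state (silent c) r i).bind (A.decision i)
  have hf : Computable₂ f := by
    refine Computable.findSome_fin (fun i => ?_) _
    refine Computable.option_bind (A.computable_state_silent.fin_eval i) ?_
    exact (A.computable_decision i).comp Computable.snd
  have hsome : ∀ c r v, f c r = some v → ∃ i, c.Correct i ∧ A.Decides (silent c) i v := by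
    intro c r v h
    obtain ⟨i, -, hi⟩ := List.exists_of_findSome?_eq_some h
    obtain ⟨s, hs, hv⟩ := Option.bind_eq_some_iff.1 hi
    exact ⟨i, A.correct_of_state _ hs, r, s, hs, hv⟩
  have hsolve := fun c => hA c c (InputConfig.Contains.refl c)
  have hdec : ∀ (c : InputConfig n t VI) i, c.Correct i → ∃ v, A.Decides (silent c) i v := by
    intro c i hi
    obtain ⟨v, hv⟩ := (hsolve c).1 i hi
    exact ⟨v, (A.decides_shadow (InputConfig.Contains.refl c) hi v).1 hv⟩
  have hagree : ∀ (c : InputConfig n t VI) i j v w, c.Correct i → c.Correct j →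
      A.Decides (silent c) i v → A.Decides (silent c) j w → v = w := by
    intro c i j v w hi hj hv hw
    exact (hsolve c).2.1 i j v w hi hj
      ((A.decides_shadow (InputConfig.Contains.refl c) hi v).2 hv)
      ((A.decides_shadow (InputConfig.Contains.refl c) hj w).2 hw)
  have hdom : ∀ c, (Nat.rfindOpt (f c)).Dom := by
    intro c
    obtain ⟨i, hi⟩ := c.exists_correct ht
    obtain ⟨v, r, s, hs, hv⟩ := hdec c i hi
    refine Nat.rfindOpt_dom.2 ⟨r, ?_⟩
    cases hr : f c r with
    | some w => exact ⟨w, rfl⟩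
    | none =>
      have := List.findSome?_eq_none_iff.1 hr i (List.mem_finRange i)
      simp [hs, hv] at this
  refine ⟨fun c => (Nat.rfindOpt (f c)).get (hdom c), ?_, ?_, ?_⟩
  · exact (Partrec.rfindOpt hf).of_eq_tot fun c => Part.get_mem (hdom c)
  all_goals
    have key : ∀ (c : InputConfig n t VI) i, c.Correct i →
        A.Decides (silent c) i ((Nat.rfindOpt (f c)).get (hdom c)) := by
      intro c i hi
      obtain ⟨r, hr⟩ := Nat.rfindOpt_spec (Part.get_mem (hdom c))
      obtain ⟨j, hj, hjv⟩ := hsome c r _ hr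
      obtain ⟨v, hv⟩ := hdec c i hi
      rwa [hagree c j i _ _ hj hi hjv hv]
  · intro c c' h
    obtain ⟨i, hi⟩ := c'.exists_correct ht
    exact (hA c c' h).2.2 i _ hi ((A.decides_shadow h hi _).2 (key c i (h.1 i hi)))
  · exact key

theorem state_eq_localState (A : Machine n VI VO Msg) (E : Execution n t VI Msg) {i : Fin n}
    {v : VI} (h : E.input.1 i = some v) (r : ℕ) :
    A.state E r i = some (A.localState i v (fun r j => A.sent E r j i) r) := by
  induction r with
  | zero => simp [state, localState, h]
  | succ r ih => simp [state, localState, ih, sent]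

/-- Processes that behave as in an execution with silent faulty processes forge no signature,
because the algorithm respects signatures and so every foreign signature they attach goes back to
a message they received. -/
theorem unforged_shadow {D : Type} [Primcodable D] (A : Machine n VI VO (SignedMsg n D))
    (hA : A.RespectsSignatures) {c c' : InputConfig n t VI} (h : c.Contains c') :
    A.Unforged (A.shadow c c') := by
  have key : ∀ (r : ℕ) (k i : Fin n), c'.Faulty k → ∀ m ∈ A.sent (silent c) r k i, ∀ sg ∈ m.2,
      c'.Faulty sg.1 ∨ ∃ r' ≤ r, ∃ j k', c'.Correct j ∧ c'.Faulty k' ∧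
        ∃ m' ∈ A.sent (A.shadow c c') r' j k', sg ∈ m'.2 := by
    intro r
    induction r using Nat.strong_induction_on with
    | _ r ih =>
      intro k i hk m hm sg hsg
      have hki : k ≠ i := by
        rintro rfl
        simp [sent, sentFrom_self] at hm
      by_cases hck : c.Correct k
      · obtain ⟨v, hv⟩ := (c.correct_iff k).1 hck
        have hst := A.state_eq_localState (silent c) hv r
        rw [sent, sentFrom_of_state A _ _ r hst hki] at hm
        rcases hA k v _ r i m hm sg hsg with rfl | ⟨r', hr', j, m', hm', hsg'⟩
        · exact Or.inl hk
        by_cases hj : c'.Correct j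
        · refine Or.inr ⟨r', hr'.le, j, k, hj, hk, m', ?_, hsg'⟩
          have hjk : j ≠ k := by
            rintro rfl
            exact hj hk
          obtain ⟨s, hs⟩ := A.exists_state (silent c : Execution n t VI (SignedMsg n D)) r' (h.1 j hj)
          rw [sent, sentFrom_of_state A _ _ r' ((A.state_shadow h r' hj).trans hs) hjk]
          rwa [sent, sentFrom_of_state A _ _ r' hs hjk] at hm'
        · have hj' : c'.Faulty j := not_not.1 hj
          rcases ih r' hr' j k hj' m' hm' sg hsg' with h1 | ⟨r'', hr'', h1⟩
          · exact Or.inl h1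
          · exact Or.inr ⟨r'', hr''.trans hr'.le, h1⟩
      · rw [sent, sentFrom_of_none A _ _ r (A.state_eq_none _ r hck) hki] at hm
        simp [silent] at hm
  exact key

end Machine

/-! ### Impossibility without signatures if a third of the processes may be faulty -/

namespace Machine

variable {n t : ℕ} {VI VO Msg : Type}

/-- The position among `p - 1`, `p`, `p + 1` at which process `j` has its copy on the infinite line
of blocks: block `p` of the line holds the copies of the processes `j ≡ p` modulo 3. -/
def nearPos (p : ℤ) (j : Fin n) : ℤ := p + (((j : ℤ) - p + 1) % 3 - 1)

/-- The position among `p`, `p + 1` at which a process `i` that is not congruent to `p + 2` modulo 3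
has its copy. -/
def pairPos (p : ℤ) (i : Fin n) : ℤ := if ((i : ℤ) - p) % 3 = 0 then p else p + 1

theorem card_residue_le (hn : n ≤ 3 * t) (a : ℤ) :
    (Finset.univ.filter fun i : Fin n => ((i : ℤ) - a) % 3 = 2).card ≤ t := by
  rw [← Finset.card_range t]
  refine Finset.card_le_card_of_injOn (fun i => (i : ℕ) / 3) ?_ ?_
  · intro i _
    have := i.2
    simp only [Finset.coe_range, Set.mem_Iio]
    omega
  · intro i hi j hj hij
    simp only [Finset.coe_filter, Finset.mem_univ, true_and, Set.mem_ofPred_eq] at hi hj hij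
    ext
    omega

/-- The input configuration of blocks `p` and `p + 1` of the line. -/
def pairInput (hn : n ≤ 3 * t) (p₀ p₁ : Fin n → VI) (p : ℤ) : InputConfig n t VI :=
  ⟨fun i => if ((i : ℤ) - p) % 3 = 2 then none
    else some (if pairPos p i < 0 then p₀ i else p₁ i), by
    have h1 := card_residue_le hn p
    have h2 := Finset.card_filter_add_card_filter_not (s := Finset.univ)
      fun i : Fin n => ((i : ℤ) - p) % 3 = 2
    rw [Finset.card_univ, Fintype.card_fin] at h2
    have h3 : (Finset.univ.filter fun i : Fin n => (if ((i : ℤ) - p) % 3 = 2 then none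
        else some (if pairPos p i < 0 then p₀ i else p₁ i)).isSome) =
        Finset.univ.filter fun i : Fin n => ¬ ((i : ℤ) - p) % 3 = 2 := by
      refine Finset.filter_congr fun i _ => ?_
      split_ifs <;> simp_all
    rw [h3]
    omega⟩

theorem pairInput_correct (hn : n ≤ 3 * t) (p₀ p₁ : Fin n → VI) (p : ℤ) (i : Fin n) :
    (pairInput hn p₀ p₁ p).Correct i ↔ ((i : ℤ) - p) % 3 ≠ 2 := by
  simp [InputConfig.Correct, pairInput]

variable [Primcodable VI] [Primcodable VO] [Primcodable Msg]

/-- The states on an infinite line of copies of the blocks `{j | j ≡ p mod 3}`, `p : ℤ`, in which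
every copy talks to the copies in its own block and in the two adjacent ones. Copies left of `0`
propose according to `p₀`, the others according to `p₁`. The value at position `p` and process `i`
matters only if `i ≡ p` modulo 3. -/
def lineState (A : Machine n VI VO Msg) (p₀ p₁ : Fin n → VI) : ℕ → ℤ → Fin n → A.State
  | 0 => fun p i => A.init i (if p < 0 then p₀ i else p₁ i)
  | r + 1 => fun p i => A.trans i (A.lineState p₀ p₁ r p i) fun j =>
      if j = i then none else A.send j (A.lineState p₀ p₁ r (nearPos p j) j) i

/-- The execution in which the correct processes are those of blocks `p` and `p + 1` of the line,
and the faulty processes simulate the rest of the line towards both blocks. -/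
def pairExecution (A : Machine n VI VO Msg) (hn : n ≤ 3 * t) (p₀ p₁ : Fin n → VI) (p : ℤ) :
    Execution n t VI Msg :=
  ⟨pairInput hn p₀ p₁ p, fun r k i =>
    A.send k (A.lineState p₀ p₁ r (nearPos (pairPos p i) k) k) i⟩

theorem state_pairExecution (A : Machine n VI VO Msg) (hn : n ≤ 3 * t) (p₀ p₁ : Fin n → VI)
    (p : ℤ) (r : ℕ) {i : Fin n} (hi : ((i : ℤ) - p) % 3 ≠ 2) :
    A.state (A.pairExecution hn p₀ p₁ p) r i = some (A.lineState p₀ p₁ r (pairPos p i) i) := by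
  induction r generalizing i with
  | zero => simp [state, lineState, pairExecution, pairInput, hi]
  | succ r ih =>
    simp only [state, lineState]
    rw [ih hi, Option.map_some]
    congr 2
    funext j
    by_cases hij : j = i
    · subst hij
      simp [sentFrom_self]
    rw [if_neg hij]
    by_cases hj : ((j : ℤ) - p) % 3 = 2
    · rw [sentFrom_of_none A _ _ r (A.state_eq_none _ r _) hij]
      · rfl
      · rw [pairExecution, pairInput_correct]
        exact not_not.2 hj
    · rw [sentFrom_of_state A _ _ r (ih hj) hij]
      have : nearPos (pairPos p i) j = pairPos p j := by
        unfold nearPos pairPos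
        split_ifs <;> omega
      rw [this]

/-- By round `r`, a block at distance more than `r` from the part of the line with other proposals
has not noticed that part. -/
theorem lineState_left (A : Machine n VI VO Msg) (p₀ p₁ : Fin n → VI) (r : ℕ) (p : ℤ)
    (hp : p + r < 0) (i : Fin n) :
    A.state (silent (InputConfig.full t p₀)) r i = some (A.lineState p₀ p₁ r p i) := by
  induction r generalizing p i with
  | zero =>
    have : p < 0 := by simpa using hp
    simp [state, lineState, silent, InputConfig.full, this]
  | succ r ih =>
    push_cast at hp
    simp only [state, lineState]
    rw [ih p (by omega) i, Option.map_some]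
    congr 2
    funext j
    by_cases hij : j = i
    · subst hij
      simp [sentFrom_self]
    rw [if_neg hij, sentFrom_of_state A _ _ r (ih (nearPos p j) _ j) hij]
    unfold nearPos
    omega

theorem lineState_right (A : Machine n VI VO Msg) (p₀ p₁ : Fin n → VI) (r : ℕ) (p : ℤ)
    (hp : r ≤ p) (i : Fin n) :
    A.state (silent (InputConfig.full t p₁)) r i = some (A.lineState p₀ p₁ r p i) := by
  induction r generalizing p i with
  | zero =>
    have : ¬ p < 0 := by simpa using hp
    simp [state, lineState, silent, InputConfig.full, this]
  | succ r ih =>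
    push_cast at hp
    simp only [state, lineState]
    rw [ih p (by omega) i, Option.map_some]
    congr 2
    funext j
    by_cases hij : j = i
    · subst hij
      simp [sentFrom_self]
    rw [if_neg hij, sentFrom_of_state A _ _ r (ih (nearPos p j) _ j) hij]
    unfold nearPos
    omega

/-- The copy of process `i` in block `p` of the line decides `v`. -/
def LineDecides (A : Machine n VI VO Msg) (p₀ p₁ : Fin n → VI) (p : ℤ) (i : Fin n) (v : VO) :
    Prop :=
  ∃ r, A.decision i (A.lineState p₀ p₁ r p i) = some v

theorem decides_pairExecution (A : Machine n VI VO Msg) (hn : n ≤ 3 * t) (p₀ p₁ : Fin n → VI)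
    (p : ℤ) {i : Fin n} (hi : ((i : ℤ) - p) % 3 ≠ 2) (v : VO) :
    A.Decides (A.pairExecution hn p₀ p₁ p) i v ↔ A.LineDecides p₀ p₁ (pairPos p i) i v := by
  simp [Decides, LineDecides, state_pairExecution A hn p₀ p₁ p _ hi]

/-- With at least three processes of which a third may be faulty, a machine that reaches agreement
in every execution makes the same decision in all fault-free executions: adjacent blocks of the
line agree, so all blocks agree, and far blocks on either side decide as in the fault-free
executions with proposals `p₀` and `p₁`. -/
theorem decision_full_eq (A : Machine n VI VO Msg) (val : ValidityProperty n t VI VO)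
    (hn : n ≤ 3 * t) (h3 : 3 ≤ n) (hA : ∀ E : Execution n t VI Msg, A.SolvesIn val E)
    (p₀ p₁ : Fin n → VI) {v₀ v₁ : VO}
    (h₀ : ∀ i, A.Decides (silent (InputConfig.full t p₀)) i v₀)
    (h₁ : ∀ i, A.Decides (silent (InputConfig.full t p₁)) i v₁) : v₀ = v₁ := by
  have hpair : ∀ p : ℤ, ∃ v, ∀ i : Fin n, ((i : ℤ) - p) % 3 ≠ 2 →
      ∀ w, A.LineDecides p₀ p₁ (pairPos p i) i w ↔ w = v := by
    intro p
    have hE := hA (A.pairExecution hn p₀ p₁ p)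
    have hc : ∀ i : Fin n, ((i : ℤ) - p) % 3 ≠ 2 →
        (A.pairExecution hn p₀ p₁ p).input.Correct i :=
      fun i => (pairInput_correct hn p₀ p₁ p i).2
    have hex : ∃ i : Fin n, ((i : ℤ) - p) % 3 ≠ 2 := by
      by_cases h : (0 - p) % 3 = 2
      · exact ⟨⟨1, by omega⟩, by push_cast; omega⟩
      · exact ⟨⟨0, by omega⟩, by push_cast; omega⟩
    obtain ⟨i₀, hi₀⟩ := hex
    obtain ⟨v, hv⟩ := hE.1 i₀ (hc i₀ hi₀)
    refine ⟨v, fun i hi w => ?_⟩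
    rw [← decides_pairExecution A hn p₀ p₁ p hi]
    constructor
    · exact fun hw => hE.2.1 i i₀ w v (hc i hi) (hc i₀ hi₀) hw hv
    · rintro rfl
      obtain ⟨u, hu⟩ := hE.1 i (hc i hi)
      rwa [hE.2.1 i₀ i w u (hc i₀ hi₀) (hc i hi) hv hu]
  choose v hv using hpair
  have hstep : ∀ p, v p = v (p + 1) := by
    intro p
    obtain ⟨i, hi⟩ : ∃ i : Fin n, ((i : ℤ) - p) % 3 = 1 :=
      ⟨⟨((1 + p) % 3).toNat, by omega⟩, by push_cast; omega⟩
    have e1 : pairPos p i = p + 1 := by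
      unfold pairPos
      rw [if_neg (by omega)]
    have e2 : pairPos (p + 1) i = p + 1 := by
      unfold pairPos
      rw [if_pos (by omega)]
    have h1 := (hv p i (by omega) (v p)).2 rfl
    rw [e1] at h1
    have h2 := hv (p + 1) i (by omega) (v p)
    rw [e2] at h2
    exact h2.1 h1
  have hconst : ∀ p, v p = v 0 := by
    intro p
    induction p using Int.induction_on with
    | zero => rfl
    | succ k ih => rw [← hstep, ih]
    | pred k ih => rw [hstep, sub_add_cancel, ih]
  let i₀ : Fin n := ⟨0, by omega⟩
  have hzero : ∀ k : ℤ, ∀ w, A.LineDecides p₀ p₁ (3 * k) i₀ w → w = v 0 := by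
    intro k w hw
    have e : pairPos (3 * k) i₀ = 3 * k := by
      unfold pairPos
      rw [if_pos (by simp only [i₀]; push_cast; omega)]
    have := hv (3 * k) i₀ (by simp only [i₀]; push_cast; omega) w
    rw [e, hconst] at this
    exact this.1 hw
  obtain ⟨r, s, hs, hd⟩ := h₀ i₀
  obtain ⟨r', s', hs', hd'⟩ := h₁ i₀
  rw [A.lineState_left p₀ p₁ r (3 * (-r - 1)) (by omega)] at hs
  rw [A.lineState_right p₀ p₁ r' (3 * r') (by omega)] at hs'
  obtain rfl := Option.some_injective _ hs
  obtain rfl := Option.some_injective _ hs'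
  rw [hzero _ v₀ ⟨r, hd⟩, hzero _ v₁ ⟨r', hd'⟩]

end Machine

/-- If `n ≤ 3 * t` and the problem is not trivial, it is not solvable without signatures. The case
`n = 2`, `t = 1` is the only one with fewer than three processes, too few for three non-empty
blocks. -/
theorem lt_of_unauthSolvable {n t : ℕ} {VI VO : Type} [Primcodable VI] [Primcodable VO]
    [Nonempty VI] (ht : t < n) (val : ValidityProperty n t VI VO) (hval : ¬ val.Trivial)
    (h21 : ¬ (n = 2 ∧ t = 1)) (h : UnauthSolvable val) : 3 * t < n := by
  obtain ⟨Msg, _, A, hA⟩ := h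
  by_contra hn
  obtain ⟨Γ, -, hΓ, hdec⟩ := A.exists_computable_decision ht val fun _ _ _ => hA _
  obtain ⟨x⟩ := ‹Nonempty VI›
  have hfull : ∀ (p : Fin n → VI) i, A.Decides (Machine.silent (InputConfig.full t p)) i
      (Γ (InputConfig.full t p)) := fun p i => hdec _ i (InputConfig.full_correct p i)
  refine hval ⟨Γ (InputConfig.full t fun _ => x), fun c => ?_⟩
  rw [A.decision_full_eq val (by omega) (by omega) hA _ (fun i => (c.1 i).getD x)
    (hfull _) (hfull _)]
  refine hΓ _ c ⟨fun i _ => InputConfig.full_correct _ i, fun i hi => ?_⟩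
  obtain ⟨y, hy⟩ := (c.correct_iff i).1 hi
  simp [InputConfig.full, hy]

/-! ### Runs of the correct processes and decisions by a reconstructed input configuration -/

namespace Machine

variable {n t : ℕ} {VI VO Msg : Type} [Primcodable VI] [Primcodable VO] [Primcodable Msg]

/-- The states of all processes when each of them follows the algorithm on the messages it receives
in `E`; the faulty processes get the proposal `x`. Unlike `Machine.state` this is a total function;
it agrees with `Machine.state` at the correct processes. -/
def run (A : Machine n VI VO Msg) (E : Execution n t VI Msg) (x : VI) (r : ℕ) (i : Fin n) :
    A.State :=
  A.localState i ((E.input.1 i).getD x) (fun r j => A.sent E r j i) r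

theorem state_eq_run (A : Machine n VI VO Msg) (E : Execution n t VI Msg) (x : VI) (r : ℕ)
    {i : Fin n} (h : E.input.Correct i) : A.state E r i = some (A.run E x r i) := by
  obtain ⟨v, hv⟩ := (E.input.correct_iff i).1 h
  rw [A.state_eq_localState E hv, run, hv, Option.getD_some]

theorem sent_eq_send (A : Machine n VI VO Msg) (E : Execution n t VI Msg) (x : VI) (r : ℕ)
    {i j : Fin n} (hj : E.input.Correct j) (hij : j ≠ i) :
    A.sent E r j i = A.send j (A.run E x r j) i :=
  A.sentFrom_of_state E _ r (A.state_eq_run E x r hj) hij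

theorem sent_eq_byz (A : Machine n VI VO Msg) (E : Execution n t VI Msg) (r : ℕ)
    {i j : Fin n} (hj : ¬ E.input.Correct j) (hij : j ≠ i) :
    A.sent E r j i = E.byz r j i :=
  A.sentFrom_of_none E _ r (A.state_eq_none E r hj) hij

theorem decision_run_mono (A : Machine n VI VO Msg) (E : Execution n t VI Msg) (x : VI)
    {r r' : ℕ} (h : r ≤ r') {i : Fin n} {v : VO} (hv : A.decision i (A.run E x r i) = some v) :
    A.decision i (A.run E x r' i) = some v := by
  induction r', h using Nat.le_induction with
  | base => exact hv
  | succ r' _ ih => exact A.decision_stable _ _ _ _ ih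

/-- It suffices that all correct processes have made the same admissible decision in some round. -/
theorem solvesIn_of_decision (A : Machine n VI VO Msg) (val : ValidityProperty n t VI VO)
    (E : Execution n t VI Msg) (x : VI) (R : ℕ) (w : VO) (hw : w ∈ val.admissible E.input)
    (h : ∀ i, E.input.Correct i → A.decision i (A.run E x R i) = some w) :
    A.SolvesIn val E := by
  have key : ∀ i v, E.input.Correct i → A.Decides E i v → v = w := by
    rintro i v hi ⟨r, s, hs, hv⟩
    rw [A.state_eq_run E x r hi] at hs
    obtain rfl := Option.some_injective _ hs
    have h1 := A.decision_run_mono E x (le_max_left r R) hv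
    have h2 := A.decision_run_mono E x (le_max_right r R) (h i hi)
    exact Option.some_injective _ (h1.symm.trans h2)
  refine ⟨fun i hi => ⟨w, R, _, A.state_eq_run E x R hi, h i hi⟩, ?_, ?_⟩
  · intro i j v v' hi hj hv hv'
    rw [key i v hi hv, key j v' hj hv']
  · intro i v hi hv
    rwa [key i v hi hv]

end Machine

section Decide

variable {n t : ℕ} {VI VO : Type} [Primcodable VI] [Primcodable VO]

/-- The value of `Γ` at the vector `u` if `u` is an input configuration. -/
def decideBy (Γ : InputConfig n t VI → VO) (u : Fin n → Option VI) : Option VO :=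
  (Encodable.decode (α := InputConfig n t VI) (@Encodable.encode _ Primcodable.toEncodable u)).map Γ

theorem computable_decideBy {Γ : InputConfig n t VI → VO} (hΓ : Computable Γ) :
    Computable (decideBy Γ) :=
  Computable.option_map (Computable.decode.comp Computable.encode) (hΓ.comp Computable.snd)

omit [Primcodable VO] in
theorem decideBy_val (Γ : InputConfig n t VI → VO) (c : InputConfig n t VI) :
    decideBy Γ c.1 = some (Γ c) := by
  have h : @Encodable.encode _ Primcodable.toEncodable c.1 = Encodable.encode c := rfl
  rw [decideBy, h, Encodable.encodek, Option.map_some]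

omit [Primcodable VI] in
/-- A vector that agrees with an input configuration at the correct processes is an input
configuration that contains it. -/
theorem InputConfig.exists_contains (c : InputConfig n t VI) (u : Fin n → Option VI)
    (h : ∀ i, c.Correct i → u i = c.1 i) : ∃ c' : InputConfig n t VI, c'.1 = u ∧ c'.Contains c := by
  refine ⟨⟨u, c.2.trans ?_⟩, rfl, fun i hi => ?_, h⟩
  · refine Nat.add_le_add_right (Finset.card_le_card fun i hi => ?_) t
    rw [Finset.mem_filter] at hi ⊢
    rwa [h i (Option.isSome_iff_ne_none.1 hi.2)]
  · simpa [Correct, h i hi] using hi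

end Decide

/-! ### The phase king algorithm -/

section Quorum

variable {n t : ℕ} {α : Type} [DecidableEq α]

/-- Some value that occurs at least `T` times in the vector `f`, if there is one. -/
def atLeast (T : ℕ) (f : Fin n → Option α) : Option α :=
  (List.finRange n).findSome? fun j =>
    if T ≤ (Finset.univ.filter fun k => f k = f j).card then f j else none

theorem le_card_of_atLeast {T : ℕ} {f : Fin n → Option α} {w : α} (h : atLeast T f = some w) :
    T ≤ (Finset.univ.filter fun k => f k = some w).card := by
  obtain ⟨j, -, hj⟩ := List.exists_of_findSome?_eq_some h
  split_ifs at hj with h1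
  rwa [hj] at h1

theorem exists_atLeast {T : ℕ} {f : Fin n → Option α} {w : α} (hT : 0 < T)
    (h : T ≤ (Finset.univ.filter fun k => f k = some w).card) : ∃ w', atLeast T f = some w' := by
  obtain ⟨j, hj⟩ := Finset.card_pos.1 (hT.trans_le h)
  rw [Finset.mem_filter] at hj
  cases h1 : atLeast T f with
  | some w' => exact ⟨w', rfl⟩
  | none =>
    have := List.findSome?_eq_none_iff.1 h1 j (List.mem_finRange j)
    rw [hj.2, if_pos h] at this
    simp at this

omit [DecidableEq α] in
theorem card_filter_and_add_le (P Q : Fin n → Prop) [DecidablePred P] [DecidablePred Q] :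
    (Finset.univ.filter P).card + (Finset.univ.filter Q).card ≤
      (Finset.univ.filter fun i => P i ∧ Q i).card + n := by
  have h1 := Finset.card_union_add_card_inter (Finset.univ.filter P) (Finset.univ.filter Q)
  have h2 := Finset.card_le_univ (Finset.univ.filter P ∪ Finset.univ.filter Q)
  rw [Fintype.card_fin] at h2
  rw [Finset.filter_and]
  omega

end Quorum

section PhaseKing

variable {n t : ℕ} {α : Type} [DecidableEq α]

/-- One phase of the phase king algorithm for one instance of consensus. `C` is the set of correct
processes; the values of process `i` are `V₀ i`, `V₂ i`, `V₃ i` at the start, after the second and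
after the third round; `fᵣ i j` is what `i` receives from `j` in round `r`; `Y₁ i` and `Y₂ i` are the
values for which `i` counted `n - t` votes in the first and in the second round. The phase preserves
agreement, and establishes it if its king is correct. -/
theorem phase_king (hn : 3 * t < n) (C : Fin n → Prop) [DecidablePred C]
    (hC : n ≤ (Finset.univ.filter C).card + t) (king : Fin n)
    (V₀ V₂ V₃ : Fin n → α) (Y₁ Y₂ : Fin n → Option α) (f₀ f₁ f₂ : Fin n → Fin n → Option α)
    (hf₀ : ∀ i j, C i → C j → f₀ i j = some (V₀ j)) (hY₁ : ∀ i, Y₁ i = atLeast (n - t) (f₀ i))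
    (hf₁ : ∀ i j, C i → C j → f₁ i j = Y₁ j) (hY₂ : ∀ i, Y₂ i = atLeast (n - t) (f₁ i))
    (hV₂ : ∀ i, V₂ i = (atLeast (t + 1) (f₁ i)).getD (V₀ i))
    (hf₂ : ∀ i j, C i → C j → f₂ i j = some (V₂ j))
    (hV₃ : ∀ i, V₃ i = if (Y₂ i).isSome then V₂ i else (f₂ i king).getD (V₂ i)) :
    (∀ w, (∀ i, C i → V₀ i = w) → ∀ i, C i → V₃ i = w) ∧
      (C king → ∃ w, ∀ i, C i → V₃ i = w) := by
  have huniq : ∀ i j w w', C i → C j → Y₁ i = some w → Y₁ j = some w' → w = w' := by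
    intro i j w w' hi hj hw hw'
    rw [hY₁] at hw hw'
    have h1 := le_card_of_atLeast hw
    have h2 := le_card_of_atLeast hw'
    have h3 := card_filter_and_add_le (fun k => f₀ i k = some w) C
    have h4 := card_filter_and_add_le (fun k => f₀ i k = some w ∧ C k) (fun k => f₀ j k = some w')
    obtain ⟨k, hk⟩ := Finset.card_pos.1
      (show 0 < (Finset.univ.filter fun k => (f₀ i k = some w ∧ C k) ∧ f₀ j k = some w').card by
        omega)
    obtain ⟨⟨h5, h6⟩, h7⟩ := (Finset.mem_filter.1 hk).2
    rw [hf₀ i k hi h6] at h5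
    rw [hf₀ j k hj h6] at h7
    exact Option.some_injective _ (h5.symm.trans h7)
  -- A value with more than `t` votes in the second round has the vote of a correct process.
  have hsupp : ∀ i w, C i → t + 1 ≤ (Finset.univ.filter fun k => f₁ i k = some w).card →
      ∃ j, C j ∧ Y₁ j = some w := by
    intro i w hi h
    have h1 := card_filter_and_add_le (fun k => f₁ i k = some w) C
    obtain ⟨k, hk⟩ := Finset.card_pos.1
      (show 0 < (Finset.univ.filter fun k => f₁ i k = some w ∧ C k).card by omega)
    obtain ⟨h2, h3⟩ := (Finset.mem_filter.1 hk).2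
    exact ⟨k, h3, by rw [← hf₁ i k hi h3, h2]⟩
  -- If a correct process counts `n - t` votes for `w`, then every correct process counts at least
  -- `n - 2 * t`, which is more than `t`.
  have hlock : ∀ i w, C i → Y₂ i = some w → ∀ j, C j → V₂ j = w := by
    intro i w hi hw j hj
    rw [hY₂] at hw
    have h1 := le_card_of_atLeast hw
    have h2 := card_filter_and_add_le (fun k => f₁ i k = some w) C
    have h3 : (Finset.univ.filter fun k => f₁ i k = some w ∧ C k).card ≤
        (Finset.univ.filter fun k => f₁ j k = some w).card := by
      refine Finset.card_le_card fun k hk => ?_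
      obtain ⟨h4, h5⟩ := (Finset.mem_filter.1 hk).2
      refine Finset.mem_filter.2 ⟨Finset.mem_univ _, ?_⟩
      rw [hf₁ j k hj h5, ← hf₁ i k hi h5, h4]
    obtain ⟨w', hw'⟩ := exists_atLeast (T := t + 1) (by omega)
      (show t + 1 ≤ (Finset.univ.filter fun k => f₁ j k = some w).card by omega)
    obtain ⟨k, hk, hkw⟩ := hsupp i w hi (by omega)
    obtain ⟨k', hk', hkw'⟩ := hsupp j w' hj (le_card_of_atLeast hw')
    rw [hV₂, hw', Option.getD_some]
    exact huniq k' k w' w hk' hk hkw' hkw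
  have hall : ∀ (f : Fin n → Option α) w, (∀ j, C j → f j = some w) →
      n - t ≤ (Finset.univ.filter fun k => f k = some w).card := by
    intro f w h
    have : (Finset.univ.filter C).card ≤ (Finset.univ.filter fun k => f k = some w).card :=
      Finset.card_le_card fun k hk =>
        Finset.mem_filter.2 ⟨Finset.mem_univ _, h k (Finset.mem_filter.1 hk).2⟩
    omega
  refine ⟨fun w hw i hi => ?_, fun hking => ?_⟩
  · have hY1 : ∀ i, C i → Y₁ i = some w := by
      intro i hi
      obtain ⟨w', hw'⟩ := exists_atLeast (by omega)
        (hall (f₀ i) w fun j hj => by rw [hf₀ i j hi hj, hw j hj])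
      have h1 := le_card_of_atLeast hw'
      have h2 := card_filter_and_add_le (fun k => f₀ i k = some w') C
      obtain ⟨k, hk⟩ := Finset.card_pos.1
        (show 0 < (Finset.univ.filter fun k => f₀ i k = some w' ∧ C k).card by omega)
      obtain ⟨h3, h4⟩ := (Finset.mem_filter.1 hk).2
      rw [hf₀ i k hi h4, hw k h4] at h3
      rw [hY₁, hw', h3]
    obtain ⟨w', hw'⟩ := exists_atLeast (by omega)
      (hall (f₁ i) w fun j hj => by rw [hf₁ i j hi hj, hY1 j hj])
    rw [← hY₂] at hw'
    obtain ⟨j, hj, hjw⟩ := hsupp i w' hi (by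
      rw [hY₂] at hw'
      have := le_card_of_atLeast hw'
      omega)
    rw [hY1 j hj] at hjw
    obtain rfl := Option.some_injective _ hjw
    rw [hV₃, hw', Option.isSome_some, if_pos rfl, hlock i w hi hw' i hi]
  · by_cases h : ∃ i w, C i ∧ Y₂ i = some w
    · obtain ⟨i, w, hi, hw⟩ := h
      refine ⟨w, fun j hj => ?_⟩
      rw [hV₃, hf₂ j king hj hking, Option.getD_some, hlock i w hi hw j hj,
        hlock i w hi hw king hking, ite_self]
    · refine ⟨V₂ king, fun j hj => ?_⟩
      have h1 : Y₂ j = none := by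
        cases h2 : Y₂ j with
        | none => rfl
        | some w => exact absurd ⟨j, w, hj, h2⟩ h
      rw [hV₃, h1, hf₂ j king hj hking]
      simp

end PhaseKing

section PhaseKingMachine

variable {n t : ℕ} {VI VO : Type}

/-- A state of the phase king algorithm run for all `n` possible senders in parallel: the number of
the round, the current values, and the values for which `n - t` votes were counted last. -/
abbrev KingState (n : ℕ) (VI : Type) : Type :=
  ℕ × (Fin n → Option VI) × (Fin n → Option (Option VI))

/-- A message of the phase king algorithm: a vote or an abstention for every sender. -/
abbrev KingMsg (n : ℕ) (VI : Type) : Type := Fin n → Option (Option VI)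

/-- The message sent in state `s` to everybody: the votes in the second round of a phase, and
the current values in all other rounds. -/
def kingMsg (s : KingState n VI) : KingMsg n VI :=
  fun k => if s.1 % 3 = 2 then s.2.2 k else some (s.2.1 k)

/-- The next state if the message from `j` is `f j`. Round `0` takes over the proposals sent in it;
then round `3 * k + m` for `m = 1, 2, 3` is the `m`-th round of the phase whose king is `k`.
Votes are counted in every round, but only the counts of the first two rounds of a phase are used. -/
def kingStep [DecidableEq VI] (t : ℕ) (s : KingState n VI) (f : Fin n → KingMsg n VI) :
    KingState n VI :=
  if 3 * t + 4 ≤ s.1 then s else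
  (s.1 + 1,
    fun k =>
      if s.1 = 0 then (f k k).getD none
      else if s.1 % 3 = 1 then s.2.1 k
      else if s.1 % 3 = 2 then (atLeast (t + 1) fun j => f j k).getD (s.2.1 k)
      else if (s.2.2 k).isSome then s.2.1 k
      else ((List.finRange n).findSome? fun j : Fin n =>
        if 3 * (j : ℕ) + 3 = s.1 then f j k else none).getD (s.2.1 k),
    fun k => atLeast (n - t) fun j => f j k)

theorem Primrec.atLeast {α β : Type} [Primcodable α] [Primcodable β] [DecidableEq β] (T : ℕ)
    {f : α → Fin n → Option β} (h : ∀ j, Primrec fun a => f a j) :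
    Primrec fun a => atLeast T (f a) := by
  refine Primrec.findSome_fin (fun j => ?_) _
  refine Primrec.ite (Primrec.nat_le.comp (Primrec.const T) ?_) (h j) (Primrec.const none)
  exact Primrec.card_filter_fin fun k => Primrec.eq.comp (h k) (h j)

variable [Primcodable VI] [Primcodable VO]

theorem primrec_kingMsg : Primrec (kingMsg : KingState n VI → KingMsg n VI) := by
  refine Primrec.fin_pi fun k => ?_
  refine Primrec.ite (Primrec.eq.comp ?_ (Primrec.const 2)) ?_ ?_
  · exact Primrec.nat_mod.comp Primrec.fst (Primrec.const 3)
  · exact (Primrec.snd.comp Primrec.snd).fin_eval k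
  · exact Primrec.option_some.comp ((Primrec.fst.comp Primrec.snd).fin_eval k)

theorem primrec_kingStep [DecidableEq VI] :
    Primrec₂ (kingStep t : KingState n VI → (Fin n → KingMsg n VI) → KingState n VI) := by
  have hr : Primrec fun p : KingState n VI × (Fin n → KingMsg n VI) => p.1.1 :=
    Primrec.fst.comp Primrec.fst
  have hv : ∀ k, Primrec fun p : KingState n VI × (Fin n → KingMsg n VI) => p.1.2.1 k := fun k =>
    (Primrec.fst.comp (Primrec.snd.comp Primrec.fst)).fin_eval k
  have hy : ∀ k, Primrec fun p : KingState n VI × (Fin n → KingMsg n VI) => p.1.2.2 k := fun k =>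
    (Primrec.snd.comp (Primrec.snd.comp Primrec.fst)).fin_eval k
  have hf : ∀ j k, Primrec fun p : KingState n VI × (Fin n → KingMsg n VI) => p.2 j k :=
    fun j k => (Primrec.snd.fin_eval j).fin_eval k
  have hm : Primrec fun p : KingState n VI × (Fin n → KingMsg n VI) => p.1.1 % 3 :=
    Primrec.nat_mod.comp hr (Primrec.const 3)
  refine Primrec.ite (Primrec.nat_le.comp (Primrec.const _) hr) Primrec.fst ?_
  refine Primrec.pair (Primrec.succ.comp hr) (Primrec.pair (Primrec.fin_pi fun k => ?_)
    (Primrec.fin_pi fun k => Primrec.atLeast _ fun j => hf j k))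
  refine Primrec.ite (Primrec.eq.comp hr (Primrec.const 0))
    (Primrec.option_getD.comp (hf k k) (Primrec.const none)) ?_
  refine Primrec.ite (Primrec.eq.comp hm (Primrec.const 1)) (hv k) ?_
  refine Primrec.ite (Primrec.eq.comp hm (Primrec.const 2))
    (Primrec.option_getD.comp (Primrec.atLeast _ fun j => hf j k) (hv k)) ?_
  refine Primrec.ite (Primrec.eq.comp (Primrec.option_isSome.comp (hy k)) (Primrec.const true))
    (hv k) ?_
  refine Primrec.option_getD.comp (Primrec.findSome_fin (fun j => ?_) _) (hv k)
  exact Primrec.ite (Primrec.eq.comp (Primrec.const _) hr) (hf j k) (Primrec.const none)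

/-- The phase king algorithm, by which all correct processes reconstruct the same input
configuration, to which they apply `Γ`. The message that a process would send to itself is
supplied by its state. -/
def kingMachine [DecidableEq VI] (Γ : InputConfig n t VI → VO) (hΓ : Computable Γ) :
    Machine n VI VO (KingMsg n VI) where
  State := KingState n VI
  init i p := (0, fun k => if k = i then some p else none, fun _ => none)
  send _ s _ := some (kingMsg s)
  trans i s rcv := kingStep t s fun j => if j = i then kingMsg s else (rcv j).getD fun _ => none
  decision _ s := if 3 * t + 4 ≤ s.1 then decideBy Γ s.2.1 else none
  decision_stable i s rcv v h := by
    split_ifs at h with h1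
    simp only [kingStep, h1, if_true, h]
  computable_init i := by
    refine Primrec.to_comp (Primrec.pair (Primrec.const 0) (Primrec.pair
      (Primrec.fin_pi fun k => ?_) (Primrec.const _)))
    by_cases h : k = i
    · simpa [h] using Primrec.option_some
    · simpa [h] using Primrec.const none
  computable_send i := by
    exact Primrec.to_comp (Primrec.fin_pi fun k => Primrec.option_some.comp primrec_kingMsg)
  computable_trans i := by
    refine Primrec₂.to_comp (Primrec₂.comp primrec_kingStep Primrec.fst
      (Primrec.fin_pi fun j => ?_))
    by_cases h : j = i
    · simpa [h] using primrec_kingMsg.comp Primrec.fst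
    · simp only [h, if_false]
      exact Primrec.option_getD.comp (Primrec.snd.fin_eval j) (Primrec.const _)
  computable_decision i := by
    have h : Computable fun s : KingState n VI => decide (3 * t + 4 ≤ s.1) :=
      (PrimrecPred.decide (Primrec.nat_le.comp (Primrec.const _) Primrec.fst)).to_comp
    refine (Computable.cond h ((computable_decideBy hΓ).comp
      (Computable.fst.comp Computable.snd)) (Computable.const none)).of_eq fun s => ?_
    by_cases h1 : 3 * t + 4 ≤ s.1 <;> simp [h1]

/-- The phase king algorithm solves every problem that satisfies the containment condition if fewer
than a third of the processes are faulty. -/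
theorem unauthSolvable_of_lt [Nonempty VI] (ht : t < n) (hn : 3 * t < n)
    (val : ValidityProperty n t VI VO) (hval : val.ContainmentCondition) :
    UnauthSolvable val := by
  classical
  obtain ⟨Γ, hΓ, hmem⟩ := hval
  obtain ⟨x⟩ := ‹Nonempty VI›
  refine ⟨KingMsg n VI, inferInstance, kingMachine Γ hΓ, fun E => ?_⟩
  let A := kingMachine Γ hΓ
  let S : ℕ → Fin n → KingState n VI := fun r i => A.run E x r i
  let f : ℕ → Fin n → Fin n → KingMsg n VI := fun r i j =>
    if j = i then kingMsg (S r i) else (A.sent E r j i).getD fun _ => none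
  have hS : ∀ r i, S (r + 1) i = kingStep t (S r i) (f r i) := fun r i => rfl
  have hf : ∀ r i j, E.input.Correct j → f r i j = kingMsg (S r j) := by
    intro r i j hj
    by_cases hij : j = i
    · simp [f, hij]
    · simp only [f, hij, if_false]
      rw [A.sent_eq_send E x r hj hij]
      rfl
  have hround : ∀ r ≤ 3 * t + 4, ∀ i, (S r i).1 = r := by
    intro r hr i
    induction r with
    | zero => rfl
    | succ r ih =>
      have := ih (by omega)
      rw [hS, kingStep, if_neg (by omega), this]
  have hC : n ≤ (Finset.univ.filter E.input.Correct).card + t := by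
    have h1 : Finset.univ.filter E.input.Correct =
        Finset.univ.filter fun i => (E.input.1 i).isSome :=
      Finset.filter_congr fun i _ => Option.isSome_iff_ne_none.symm
    rw [h1]
    exact E.input.2
  have hphase : ∀ (k : Fin n), (k : ℕ) ≤ t → ∀ s : Fin n,
      (∀ w, (∀ i, E.input.Correct i → (S (3 * k + 1) i).2.1 s = w) →
        ∀ i, E.input.Correct i → (S (3 * k + 4) i).2.1 s = w) ∧
      (E.input.Correct k → ∃ w, ∀ i, E.input.Correct i → (S (3 * k + 4) i).2.1 s = w) := by
    intro k hk s
    have hr1 := hround (3 * k + 1) (by omega)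
    have hr2 := hround (3 * k + 2) (by omega)
    have hr3 := hround (3 * k + 3) (by omega)
    have hV1 : ∀ i, (S (3 * k + 2) i).2.1 s = (S (3 * k + 1) i).2.1 s := by
      intro i
      rw [hS, kingStep, if_neg (by rw [hr1]; omega)]
      simp only [hr1]
      rw [if_neg (by omega), if_pos (by omega)]
    refine phase_king hn E.input.Correct hC k _ (fun i => (S (3 * k + 3) i).2.1 s) _
      (fun i => (S (3 * k + 2) i).2.2 s) (fun i => (S (3 * k + 3) i).2.2 s)
      (fun i j => f (3 * k + 1) i j s) (fun i j => f (3 * k + 2) i j s)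
      (fun i j => f (3 * k + 3) i j s) ?_ ?_ ?_ ?_ ?_ ?_ ?_
    · intro i j _ hj
      rw [hf _ i j hj, kingMsg, hr1, if_neg (by omega)]
    · intro i
      rw [hS, kingStep, if_neg (by rw [hr1]; omega)]
    · intro i j _ hj
      rw [hf _ i j hj, kingMsg, hr2, if_pos (by omega)]
    · intro i
      rw [hS, kingStep, if_neg (by rw [hr2]; omega)]
    · intro i
      rw [hS, kingStep, if_neg (by rw [hr2]; omega)]
      simp only [hr2]
      rw [if_neg (by omega), if_neg (by omega), if_pos (by omega), hV1]
    · intro i j _ hj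
      rw [hf _ i j hj, kingMsg, hr3, if_neg (by omega)]
    · intro i
      rw [hS, kingStep, if_neg (by rw [hr3]; omega)]
      simp only [hr3]
      rw [if_neg (by omega), if_neg (by omega), if_neg (by omega)]
      have hking : ((List.finRange n).findSome? fun j : Fin n =>
          if 3 * (j : ℕ) + 3 = 3 * (k : ℕ) + 3 then f (3 * k + 3) i j s else none) =
          f (3 * k + 3) i k s := by
        have h1 : (fun j : Fin n =>
            if 3 * (j : ℕ) + 3 = 3 * (k : ℕ) + 3 then f (3 * k + 3) i j s else none) =
            fun j => if j = k then f (3 * k + 3) i k s else none := by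
          funext j
          by_cases h : j = k
          · subst h
            simp
          · rw [if_neg h, if_neg fun h' => h (Fin.ext (by omega))]
        rw [h1]
        cases h2 : f (3 * k + 3) i k s with
        | none => simp
        | some w =>
          cases h3 : (List.finRange n).findSome? fun j => if j = k then some w else none with
          | none => simpa using List.findSome?_eq_none_iff.1 h3 k (List.mem_finRange k)
          | some w' =>
            obtain ⟨j, -, hj⟩ := List.exists_of_findSome?_eq_some h3
            split_ifs at hj
            rw [hj]
      rw [hking]
  -- Agreement on the value for sender `s`, once reached, persists.
  have hpersist : ∀ (s : Fin n) w m k, k + m = t + 1 →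
      (∀ i, E.input.Correct i → (S (3 * k + 1) i).2.1 s = w) →
      ∀ i, E.input.Correct i → (S (3 * t + 4) i).2.1 s = w := by
    intro s w m
    induction m with
    | zero =>
      intro k hk h
      rwa [show 3 * k + 1 = 3 * t + 4 by omega] at h
    | succ m ih =>
      intro k hk h
      exact ih (k + 1) (by omega) ((hphase ⟨k, by omega⟩ (by simp only; omega) s).1 w h)
  have hvalid : ∀ s, E.input.Correct s → ∀ i, E.input.Correct i →
      (S (3 * t + 4) i).2.1 s = E.input.1 s := by
    intro s hs
    refine hpersist s _ (t + 1) 0 (by omega) fun i hi => ?_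
    obtain ⟨v, hv⟩ := (E.input.correct_iff s).1 hs
    have h0 := hround 0 (by omega)
    rw [mul_zero, zero_add, ← zero_add 1, hS, kingStep, if_neg (by rw [h0]; omega)]
    simp only [h0, if_true]
    rw [hf 0 i s hs, kingMsg, h0, if_neg (by omega), Option.getD_some]
    have : S 0 s = (0, fun k => if k = s then some ((E.input.1 s).getD x) else none,
      fun _ => none) := rfl
    simp [this, hv]
  -- One of the `t + 1` kings is correct.
  obtain ⟨k, hkt, hk⟩ : ∃ k : Fin n, (k : ℕ) ≤ t ∧ E.input.Correct k := by
    have h1 := card_filter_and_add_le (fun k : Fin n => (k : ℕ) ≤ t) E.input.Correct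
    have h2 : t + 1 ≤ (Finset.univ.filter fun k : Fin n => (k : ℕ) ≤ t).card := by
      rw [← Finset.card_range (t + 1)]
      refine Finset.card_le_card_of_surjOn (fun k : Fin n => (k : ℕ)) fun m hm => ?_
      have hm' : m < t + 1 := by simpa using hm
      exact ⟨⟨m, by omega⟩, by simp; omega, rfl⟩
    obtain ⟨k, hk⟩ := Finset.card_pos.1
      (show 0 < (Finset.univ.filter fun k : Fin n => (k : ℕ) ≤ t ∧ E.input.Correct k).card by
        omega)
    exact ⟨k, (Finset.mem_filter.1 hk).2⟩
  have hagree : ∀ s, ∃ w, ∀ i, E.input.Correct i → (S (3 * t + 4) i).2.1 s = w := by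
    intro s
    obtain ⟨w, hw⟩ := (hphase k hkt s).2 hk
    exact ⟨w, hpersist s w (t - k) (k + 1) (by omega) hw⟩
  choose u hu using hagree
  obtain ⟨c, hcu, hc⟩ := E.input.exists_contains u fun s hs => by
    rw [← hu s k hk, hvalid s hs k hk]
  refine A.solvesIn_of_decision val E x (3 * t + 4) (Γ c) (hmem c _ hc) fun i hi => ?_
  have h1 : (S (3 * t + 4) i).2.1 = c.1 := by
    rw [hcu]
    exact funext fun s => hu s i hi
  have h2 : A.decision i (S (3 * t + 4) i) = if 3 * t + 4 ≤ (S (3 * t + 4) i).1 then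
    decideBy Γ (S (3 * t + 4) i).2.1 else none := rfl
  rw [h2, hround _ le_rfl, if_pos le_rfl, h1, decideBy_val]

end PhaseKingMachine

/-! ### The Dolev–Strong algorithm -/

section DolevStrong

variable {n t : ℕ} {VI VO : Type}

/-- The only member of the list `L`, if `L` has exactly one member up to repetitions. -/
def uniqueMem {β : Type} [DecidableEq β] (L : List β) : Option β :=
  L.head?.bind fun v => if ∀ w ∈ L, w = v then some v else none

theorem uniqueMem_eq_some {β : Type} [DecidableEq β] (L : List β) (v : β) :
    uniqueMem L = some v ↔ v ∈ L ∧ ∀ w ∈ L, w = v := by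
  cases L with
  | nil => simp [uniqueMem]
  | cons a L =>
    simp only [uniqueMem, List.head?_cons, Option.bind_some, Option.ite_none_right_eq_some,
      Option.some.injEq]
    constructor
    · rintro ⟨h, rfl⟩
      exact ⟨List.mem_cons_self, h⟩
    · rintro ⟨-, h⟩
      obtain rfl := h a List.mem_cons_self
      exact ⟨h, rfl⟩

theorem uniqueMem_congr {β : Type} [DecidableEq β] {L L' : List β} (h : ∀ v, v ∈ L ↔ v ∈ L') :
    uniqueMem L = uniqueMem L' := by
  ext v
  simp only [uniqueMem_eq_some, h]

/-- The content of signatures: `(s, v)` says that process `s` proposes `v`. -/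
abbrev Claim (n : ℕ) (VI : Type) : Type := Fin n × VI

/-- A state of the Dolev–Strong algorithm: the number of the round, the claim of the process itself
(it only serves as the payload of its messages), and all signatures it knows. -/
abbrev ChainState (n : ℕ) (VI : Type) : Type :=
  ℕ × Claim n VI × List (Signature n (Claim n VI))

/-- The signatures known after a round with received messages `rcv`, before signing. -/
def gather (s : ChainState n VI) (rcv : Fin n → Option (SignedMsg n (Claim n VI))) :
    List (Signature n (Claim n VI)) :=
  s.2.2 ++ (List.finRange n).flatMap fun j => ((rcv j).map Prod.snd).getD []

variable [DecidableEq VI]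

/-- The claim `x` is accepted on the basis of the signatures in `K` at the end of round `r`: it is
signed by the process that it is about, and by at least `r + 1` processes in total. -/
def Accepts (r : ℕ) (K : List (Signature n (Claim n VI))) (x : Claim n VI) : Prop :=
  (x.1, x) ∈ K ∧ r + 1 ≤ (Finset.univ.filter fun k => (k, x) ∈ K).card

instance (r : ℕ) (K : List (Signature n (Claim n VI))) : DecidablePred (Accepts r K) :=
  fun _ => inferInstanceAs (Decidable (_ ∧ _))

/-- The claims accepted at the end of round `r`. -/
def accepted (r : ℕ) (K : List (Signature n (Claim n VI))) : List (Claim n VI) :=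
  (K.map Prod.snd).filter fun x => Accepts r K x

theorem mem_accepted (r : ℕ) (K : List (Signature n (Claim n VI))) (x : Claim n VI) :
    x ∈ accepted r K ↔ Accepts r K x := by
  simp only [accepted, List.mem_filter, List.mem_map, decide_eq_true_eq, and_iff_right_iff_imp]
  exact fun h => ⟨_, h.1, rfl⟩

/-- In rounds `0` to `t`, process `i` adds its signature to all claims that it accepts. -/
def chainStep (t : ℕ) (i : Fin n) (s : ChainState n VI)
    (rcv : Fin n → Option (SignedMsg n (Claim n VI))) : ChainState n VI :=
  if t + 1 ≤ s.1 then s else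
  (s.1 + 1, s.2.1, gather s rcv ++ (accepted s.1 (gather s rcv)).map fun x => (i, x))

/-- The proposals reconstructed by process `i`: that of `k` is the only value for which `i` has
signed a claim about `k`. -/
def reconstruct (i : Fin n) (s : ChainState n VI) : Fin n → Option VI :=
  fun k => uniqueMem (s.2.2.filterMap fun sg =>
    if sg.1 = i ∧ sg.2.1 = k then some sg.2.2 else none)

omit [DecidableEq VI] in
theorem mem_reconstruct (i k : Fin n) (K : List (Signature n (Claim n VI))) (v : VI) :
    v ∈ (K.filterMap fun sg => if sg.1 = i ∧ sg.2.1 = k then some sg.2.2 else none) ↔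
      (i, (k, v)) ∈ K := by
  simp only [List.mem_filterMap, Option.ite_none_right_eq_some, Option.some.injEq]
  constructor
  · rintro ⟨⟨a, b, w⟩, h, ⟨rfl, rfl⟩, rfl⟩
    exact h
  · exact fun h => ⟨_, h, ⟨rfl, rfl⟩, rfl⟩

section Computability

variable [Primcodable VI] [Primcodable VO]

theorem Primrec.uniqueMem {β : Type} [Primcodable β] [DecidableEq β] :
    Primrec (uniqueMem : List β → Option β) := by
  have h : PrimrecRel fun (L : List β) (v : β) => ∀ w ∈ L, w = v :=
    PrimrecRel.forall_mem_list Primrec.eq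
  exact Primrec.option_bind Primrec.list_head?
    (Primrec.ite h (Primrec.option_some.comp Primrec.snd) (Primrec.const none))

theorem PrimrecRel.list_mem {β : Type} [Primcodable β] :
    PrimrecRel fun (L : List β) (b : β) => b ∈ L := by
  have h : PrimrecRel fun (L : List β) (b : β) => ∃ a ∈ L, a = b :=
    PrimrecRel.exists_mem_list Primrec.eq
  refine h.of_eq fun L b => ?_
  simp

omit [DecidableEq VI] in
theorem primrec_gather :
    Primrec₂ (gather : ChainState n VI → (Fin n → Option (SignedMsg n (Claim n VI))) → _) := by
  refine Primrec.list_append.comp (Primrec.snd.comp (Primrec.snd.comp Primrec.fst)) ?_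
  suffices h : ∀ l : List (Fin n), Primrec fun p : ChainState n VI ×
      (Fin n → Option (SignedMsg n (Claim n VI))) =>
      l.flatMap fun j => ((p.2 j).map Prod.snd).getD [] from h _
  intro l
  induction l with
  | nil => simpa using Primrec.const []
  | cons j l ih =>
    simp only [List.flatMap_cons]
    refine Primrec.list_append.comp (Primrec.option_getD.comp ?_ (Primrec.const [])) ih
    exact Primrec.option_map (Primrec.snd.fin_eval j) (Primrec.snd.comp Primrec.snd)

theorem primrec_accepted :
    Primrec₂ (accepted : ℕ → List (Signature n (Claim n VI)) → List (Claim n VI)) := by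
  have h : PrimrecRel fun (x : Claim n VI) (p : ℕ × List (Signature n (Claim n VI))) =>
      Accepts p.1 p.2 x := by
    have hK : Primrec fun q : Claim n VI × ℕ × List (Signature n (Claim n VI)) => q.2.2 :=
      Primrec.snd.comp Primrec.snd
    refine PrimrecPred.and ?_ ?_
    · exact PrimrecRel.list_mem.comp hK
        (Primrec.pair (Primrec.fst.comp Primrec.fst) Primrec.fst)
    · refine Primrec.nat_le.comp (Primrec.succ.comp (Primrec.fst.comp Primrec.snd)) ?_
      exact Primrec.card_filter_fin fun k => PrimrecRel.list_mem.comp hK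
        (Primrec.pair (Primrec.const k) Primrec.fst)
  have h1 := PrimrecRel.listFilter h
  exact h1.comp (Primrec.list_map Primrec.snd (Primrec.snd.comp Primrec.snd)) Primrec.id

theorem primrec_chainStep (i : Fin n) :
    Primrec₂ (chainStep t i : ChainState n VI → _ → ChainState n VI) := by
  have hr : Primrec fun p : ChainState n VI × (Fin n → Option (SignedMsg n (Claim n VI))) =>
      p.1.1 := Primrec.fst.comp Primrec.fst
  refine Primrec.ite (Primrec.nat_le.comp (Primrec.const _) hr) Primrec.fst ?_
  refine Primrec.pair (Primrec.succ.comp hr)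
    (Primrec.pair (Primrec.fst.comp (Primrec.snd.comp Primrec.fst)) ?_)
  refine Primrec.list_append.comp primrec_gather (Primrec.list_map
    (primrec_accepted.comp hr primrec_gather) (Primrec.pair (Primrec.const i) Primrec.snd))

theorem primrec_reconstruct (i : Fin n) :
    Primrec (reconstruct i : ChainState n VI → Fin n → Option VI) := by
  refine Primrec.fin_pi fun k => Primrec.uniqueMem.comp ?_
  refine Primrec.listFilterMap (Primrec.snd.comp Primrec.snd) ?_
  refine Primrec.ite (PrimrecPred.and ?_ ?_) ?_ (Primrec.const none)
  · exact Primrec.eq.comp (Primrec.fst.comp Primrec.snd) (Primrec.const i)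
  · exact Primrec.eq.comp (Primrec.fst.comp (Primrec.snd.comp Primrec.snd)) (Primrec.const k)
  · exact Primrec.option_some.comp (Primrec.snd.comp (Primrec.snd.comp Primrec.snd))

/-- The Dolev–Strong algorithm, by which all correct processes reconstruct the same input
configuration, to which they apply `Γ`. -/
def chainMachine (Γ : InputConfig n t VI → VO) (hΓ : Computable Γ) :
    Machine n VI VO (SignedMsg n (Claim n VI)) where
  State := ChainState n VI
  init i p := (0, (i, p), [(i, (i, p))])
  send _ s _ := some s.2
  trans i s rcv := chainStep t i s rcv
  decision i s := if t + 1 ≤ s.1 then decideBy Γ (reconstruct i s) else none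
  decision_stable i s rcv v h := by
    split_ifs at h with h1
    simp only [chainStep, h1, if_true, h]
  computable_init i := by
    have h : Primrec fun p : VI => (i, p) := Primrec.pair (Primrec.const i) Primrec.id
    exact Primrec.to_comp (Primrec.pair (Primrec.const 0) (Primrec.pair h
      (Primrec.list_cons.comp (Primrec.pair (Primrec.const i) h) (Primrec.const []))))
  computable_send i :=
    Primrec.to_comp (Primrec.fin_pi fun _ => Primrec.option_some.comp Primrec.snd)
  computable_trans i := (primrec_chainStep i).to_comp
  computable_decision i := by
    have h : Computable fun s : ChainState n VI => decide (t + 1 ≤ s.1) :=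
      (PrimrecPred.decide (Primrec.nat_le.comp (Primrec.const _) Primrec.fst)).to_comp
    refine (Computable.cond h ((computable_decideBy hΓ).comp (primrec_reconstruct i).to_comp)
      (Computable.const none)).of_eq fun s => ?_
    by_cases h1 : t + 1 ≤ s.1 <;> simp [h1]

end Computability

omit [DecidableEq VI] in
theorem mem_gather (s : ChainState n VI) (rcv : Fin n → Option (SignedMsg n (Claim n VI)))
    (sg : Signature n (Claim n VI)) :
    sg ∈ gather s rcv ↔ sg ∈ s.2.2 ∨ ∃ j, ∃ m ∈ rcv j, sg ∈ m.2 := by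
  simp only [gather, List.mem_append, List.mem_flatMap, List.mem_finRange, true_and,
    Option.mem_def]
  refine or_congr_right (exists_congr fun j => ?_)
  cases rcv j <;> simp

theorem chainStep_of_le {i : Fin n} {s : ChainState n VI}
    {rcv : Fin n → Option (SignedMsg n (Claim n VI))} (hs : t + 1 ≤ s.1) :
    chainStep t i s rcv = s := if_pos hs

theorem mem_chainStep {i : Fin n} {s : ChainState n VI}
    {rcv : Fin n → Option (SignedMsg n (Claim n VI))} (hs : ¬ t + 1 ≤ s.1)
    (sg : Signature n (Claim n VI)) :
    sg ∈ (chainStep t i s rcv).2.2 ↔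
      sg ∈ gather s rcv ∨ sg.1 = i ∧ Accepts s.1 (gather s rcv) sg.2 := by
  simp only [chainStep, if_neg hs, List.mem_append, List.mem_map, mem_accepted]
  refine or_congr_right ⟨?_, ?_⟩
  · rintro ⟨x, hx, rfl⟩
    exact ⟨rfl, hx⟩
  · rintro ⟨rfl, hx⟩
    exact ⟨_, hx, rfl⟩

variable [Primcodable VI] [Primcodable VO]

theorem respectsSignatures_chainMachine (Γ : InputConfig n t VI → VO) (hΓ : Computable Γ) :
    (chainMachine Γ hΓ).RespectsSignatures := by
  intro i v rcv r k m hm sg hsg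
  obtain rfl : ((chainMachine Γ hΓ).localState i v rcv r).2 = m := Option.some_injective _ hm
  clear hm
  induction r with
  | zero =>
    obtain rfl := List.mem_singleton.1 hsg
    exact Or.inl rfl
  | succ r ih =>
    have hold : sg ∈ ((chainMachine Γ hΓ).localState i v rcv r).2.2 → sg.1 = i ∨
        ∃ r' < r + 1, ∃ j, ∃ m' ∈ rcv r' j, sg ∈ m'.2 := fun h =>
      (ih h).imp_right fun ⟨r', hr', h'⟩ => ⟨r', by omega, h'⟩
    change sg ∈ (chainStep t i ((chainMachine Γ hΓ).localState i v rcv r) (rcv r)).2.2 at hsg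
    by_cases hs : t + 1 ≤ ((chainMachine Γ hΓ).localState i v rcv r).1
    · rw [chainStep_of_le hs] at hsg
      exact hold hsg
    · rcases (mem_chainStep hs sg).1 hsg with h | h
      · rcases (mem_gather _ _ sg).1 h with h | h
        · exact hold h
        · exact Or.inr ⟨r, by omega, h⟩
      · exact Or.inl h.1

/-- The Dolev–Strong algorithm solves every problem that satisfies the containment condition: a claim
accepted by a correct process before round `t` is relayed with one more signature and so accepted by
all in the next round, and a claim accepted in round `t` has `t + 1` signatures, one of them by a
correct process that accepted the claim earlier. -/
theorem authSolvable_of_containment [Nonempty VI] (ht : t < n) (val : ValidityProperty n t VI VO)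
    (hval : val.ContainmentCondition) : AuthSolvable val := by
  obtain ⟨Γ, hΓ, hmem⟩ := hval
  obtain ⟨x₀⟩ := ‹Nonempty VI›
  refine ⟨Claim n VI, inferInstance, chainMachine Γ hΓ,
    respectsSignatures_chainMachine Γ hΓ, fun E hE => ?_⟩
  let A := chainMachine Γ hΓ
  let C := E.input.Correct
  let S : ℕ → Fin n → ChainState n VI := fun r i => A.run E x₀ r i
  let K : ℕ → Fin n → List (Signature n (Claim n VI)) := fun r i => (S r i).2.2
  let G : ℕ → Fin n → List (Signature n (Claim n VI)) := fun r i =>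
    gather (S r i) fun j => A.sent E r j i
  have hS : ∀ r i, S (r + 1) i = chainStep t i (S r i) fun j => A.sent E r j i := fun r i => rfl
  have hround : ∀ r ≤ t + 1, ∀ i, (S r i).1 = r := by
    intro r hr i
    induction r with
    | zero => rfl
    | succ r ih =>
      have := ih (by omega)
      rw [hS, chainStep, if_neg (by omega), this]
  have hKstep : ∀ r ≤ t, ∀ i sg, sg ∈ K (r + 1) i ↔
      sg ∈ G r i ∨ sg.1 = i ∧ Accepts r (G r i) sg.2 := by
    intro r hr i sg
    have h := hround r (by omega) i
    have h1 := mem_chainStep (t := t) (i := i) (s := S r i) (rcv := fun j => A.sent E r j i)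
      (by omega) sg
    rw [h] at h1
    exact h1
  have hKG : ∀ r i, K r i ⊆ G r i := fun r i sg h => (mem_gather _ _ sg).2 (Or.inl h)
  have hmono1 : ∀ r i, K r i ⊆ K (r + 1) i := by
    intro r i sg h
    change sg ∈ (S (r + 1) i).2.2
    by_cases hs : t + 1 ≤ (S r i).1
    · rw [hS, chainStep_of_le hs]
      exact h
    · rw [hS]
      exact (mem_chainStep hs sg).2 (Or.inl (hKG r i h))
  have hmono : ∀ r r', r ≤ r' → ∀ i, K r i ⊆ K r' i := fun r r' h i => by
    induction r', h using Nat.le_induction with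
    | base => exact fun _ h => h
    | succ r' _ ih => exact fun _ h => hmono1 r' i (ih h)
  have hsent : ∀ r i j, C j → j ≠ i → A.sent E r j i = some (S r j).2 := fun r i j hj hij =>
    A.sent_eq_send E x₀ r hj hij
  have hdeliver : ∀ r i j, C j → K r j ⊆ G r i := by
    intro r i j hj sg h
    by_cases hij : j = i
    · subst hij
      exact hKG r j h
    · exact (mem_gather _ _ sg).2 (Or.inr ⟨j, _, hsent r i j hj hij, h⟩)
  -- A signature of a correct process `k` that some correct process knows is known to `k`.
  have hUstep : ∀ r k x, C k → (∀ r' ≤ r, ∀ i, C i → (k, x) ∈ K r' i → (k, x) ∈ K r' k) →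
      ∀ i, C i → (k, x) ∈ G r i → (k, x) ∈ K r k := by
    intro r k x hk ih i hi h
    rcases (mem_gather _ _ _).1 h with h | ⟨j, m, hm, h⟩
    · exact ih r le_rfl i hi h
    have hij : j ≠ i := by
      rintro rfl
      simp [Machine.sent, Machine.sentFrom_self] at hm
    by_cases hj : C j
    · rw [hsent r i j hj hij] at hm
      obtain rfl := Option.some_injective _ hm
      exact ih r le_rfl j hj h
    · rw [A.sent_eq_byz E r hj hij] at hm
      rcases hE r j i (not_not.1 hj) m hm _ h with h1 | ⟨r', hr', j', k', hj', hk', m', hm', h'⟩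
      · exact absurd h1 hk
      · have hne : j' ≠ k' := by
          rintro rfl
          exact hj' hk'
        rw [hsent r' k' j' hj' hne] at hm'
        obtain rfl := Option.some_injective _ hm'
        exact hmono r' r hr' k (ih r' hr' j' hj' h')
  have hU : ∀ r ≤ t + 1, ∀ k x, C k → ∀ i, C i → (k, x) ∈ K r i → (k, x) ∈ K r k := by
    intro r
    induction r using Nat.strong_induction_on with
    | _ r ih =>
      intro hr k x hk i hi h
      cases r with
      | zero =>
        have h1 := List.mem_singleton.1 h
        obtain rfl : k = i := congrArg Prod.fst h1
        exact h
      | succ r =>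
        rcases (hKstep r (by omega) i _).1 h with h | ⟨rfl, -⟩
        · exact hmono1 r k (hUstep r k x hk
            (fun r' hr' i hi h => ih r' (by omega) (by omega) k x hk i hi h) i hi h)
        · exact h
  have hUG : ∀ r ≤ t, ∀ k x, C k → ∀ i, C i → (k, x) ∈ G r i → (k, x) ∈ K r k :=
    fun r hr k x hk i hi h => hUstep r k x hk
      (fun r' hr' i hi h => hU r' (by omega) k x hk i hi h) i hi h
  have hKsucc : ∀ r ≤ t, ∀ k x, C k → (k, x) ∈ K (r + 1) k →
      (k, x) ∈ K r k ∨ Accepts r (G r k) x := by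
    intro r hr k x hk h
    rcases (hKstep r hr k _).1 h with h | h
    · exact Or.inl (hUG r hr k x hk k hk h)
    · exact Or.inr h.2
  -- A correct process signs no false claim about itself.
  have hown : ∀ r ≤ t + 1, ∀ s v, C s → (s, (s, v)) ∈ K r s → E.input.1 s = some v := by
    intro r hr s v hs h
    induction r with
    | zero =>
      obtain ⟨w, hw⟩ := (E.input.correct_iff s).1 hs
      have h1 : (s, (s, v)) = (s, (s, (E.input.1 s).getD x₀)) := List.mem_singleton.1 h
      simp only [Prod.mk.injEq, true_and] at h1
      rw [h1, hw, Option.getD_some]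
    | succ r ih =>
      rcases hKsucc r (by omega) s _ hs h with h | h
      · exact ih (by omega) h
      · exact ih (by omega) (hUG r (by omega) s _ hs s hs h.1)
  have hagree : ∀ x i j, C i → C j → (i, x) ∈ K (t + 1) i → (j, x) ∈ K (t + 1) j := by
    intro x i j hi hj h
    -- The first round by which a correct process has signed `x`.
    have hex : ∃ r, ∃ k, C k ∧ (k, x) ∈ K r k := ⟨t + 1, i, hi, h⟩
    classical
    obtain ⟨k, hk, hkx⟩ := Nat.find_spec hex
    have hmin := fun r (hr : r < Nat.find hex) k hk hkx => Nat.find_min hex hr ⟨k, hk, hkx⟩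
    have hle : Nat.find hex ≤ t + 1 := Nat.find_min' hex ⟨i, hi, h⟩
    generalize Nat.find hex = r at hkx hmin hle
    -- In round `t`, acceptance takes `t + 1` signatures, one of them by a correct process.
    have hr : r ≤ t := by
      by_contra hr
      obtain rfl : r = t + 1 := by omega
      rcases hKsucc t le_rfl k x hk hkx with h1 | ⟨-, h1⟩
      · exact hmin t (by omega) k hk h1
      have h2 := card_filter_and_add_le (fun k' => (k', x) ∈ G t k)
        (fun i => (E.input.1 i).isSome)
      have h3 := E.input.2
      obtain ⟨k', hk'⟩ := Finset.card_pos.1 (show 0 < (Finset.univ.filter fun k' =>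
        (k', x) ∈ G t k ∧ (E.input.1 k').isSome).card by omega)
      obtain ⟨h4, h5⟩ := (Finset.mem_filter.1 hk').2
      have hCk' : C k' := Option.isSome_iff_ne_none.1 h5
      exact hmin t (by omega) k' hCk' (hUG t le_rfl k' x hCk' k hk h4)
    -- After signing, `k` knows one more signature than it needed, enough for round `r`.
    have hacc : Accepts r (K r k) x := by
      cases r with
      | zero =>
        have h1 := List.mem_singleton.1 hkx
        have h2 : x.1 = k := congrArg (fun sg => sg.2.1) h1
        exact ⟨by rwa [h2], Finset.card_pos.2 ⟨k, Finset.mem_filter.2 ⟨Finset.mem_univ _, hkx⟩⟩⟩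
      | succ r =>
        have hnot : (k, x) ∉ K r k := hmin r (by omega) k hk
        rcases hKsucc r (by omega) k x hk hkx with h1 | ⟨h1, h2⟩
        · exact absurd h1 hnot
        have hGK : ∀ sg ∈ G r k, sg ∈ K (r + 1) k := fun sg hsg =>
          (hKstep r (by omega) k sg).2 (Or.inl hsg)
        refine ⟨hGK _ h1, ?_⟩
        have h3 : (Finset.univ.filter fun k' => (k', x) ∈ G r k) ⊂
            Finset.univ.filter fun k' => (k', x) ∈ K (r + 1) k := by
          refine Finset.ssubset_iff_exists_cons_subset.2 ⟨k, ?_, ?_⟩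
          · intro h4
            exact hnot (hUG r (by omega) k x hk k hk (Finset.mem_filter.1 h4).2)
          · intro k' hk'
            refine Finset.mem_filter.2 ⟨Finset.mem_univ _, ?_⟩
            rcases Finset.mem_cons.1 hk' with rfl | hk'
            · exact hkx
            · exact hGK _ (Finset.mem_filter.1 hk').2
        have := Finset.card_lt_card h3
        omega
    have hacc' : Accepts r (G r j) x := by
      refine ⟨hdeliver r j k hk hacc.1, hacc.2.trans (Finset.card_le_card fun k' hk' => ?_)⟩
      exact Finset.mem_filter.2 ⟨Finset.mem_univ _, hdeliver r j k hk (Finset.mem_filter.1 hk').2⟩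
    exact hmono (r + 1) (t + 1) (by omega) j ((hKstep r hr j _).2 (Or.inr ⟨rfl, hacc'⟩))
  obtain ⟨i₀, hi₀⟩ := E.input.exists_correct ht
  have hsame : ∀ i, C i → reconstruct i (S (t + 1) i) = reconstruct i₀ (S (t + 1) i₀) := by
    intro i hi
    funext k
    refine uniqueMem_congr fun v => ?_
    rw [mem_reconstruct, mem_reconstruct]
    exact ⟨hagree _ i i₀ hi hi₀, hagree _ i₀ i hi₀ hi⟩
  have hvalid : ∀ s, C s → reconstruct i₀ (S (t + 1) i₀) s = E.input.1 s := by
    intro s hs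
    rw [← hsame s hs]
    obtain ⟨v, hv⟩ := (E.input.correct_iff s).1 hs
    rw [hv]
    refine (uniqueMem_eq_some _ v).2 ⟨(mem_reconstruct _ _ _ _).2 ?_, fun w hw => ?_⟩
    · refine hmono 0 (t + 1) (by omega) s (List.mem_singleton.2 ?_)
      change (s, (s, v)) = (s, (s, (E.input.1 s).getD x₀))
      rw [hv, Option.getD_some]
    · have h1 := hown (t + 1) le_rfl s w hs ((mem_reconstruct _ _ _ _).1 hw)
      exact Option.some_injective _ (h1.symm.trans hv)
  obtain ⟨c, hcu, hc⟩ := E.input.exists_contains _ hvalid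
  refine A.solvesIn_of_decision val E x₀ (t + 1) (Γ c) (hmem c _ hc) fun i hi => ?_
  have h2 : A.decision i (S (t + 1) i) = if t + 1 ≤ (S (t + 1) i).1 then
    decideBy Γ (reconstruct i (S (t + 1) i)) else none := rfl
  rw [h2, hround _ le_rfl, if_pos le_rfl, hsame i hi, ← hcu, decideBy_val]

end DolevStrong

/-! ### The general solvability theorem -/

theorem theorem4 (n t : ℕ) (ht : t < n) (VI VO : Type) [Primcodable VI] [Primcodable VO]
    [Nonempty VI] (val : ValidityProperty n t VI VO) (hval : ¬ val.Trivial) :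
    (AuthSolvable val ↔ val.ContainmentCondition) ∧
    (¬ (n = 2 ∧ t = 1) →
      (UnauthSolvable val ↔ val.ContainmentCondition ∧ 3 * t < n)) := by
  classical
  refine ⟨⟨?_, authSolvable_of_containment ht val⟩, fun h21 => ⟨fun h => ⟨?_, ?_⟩, fun h => ?_⟩⟩
  · rintro ⟨D, _, A, hA, hsolve⟩
    obtain ⟨Γ, hΓ, hmem, -⟩ := A.exists_computable_decision ht val fun _ _ hc =>
      hsolve _ (A.unforged_shadow hA hc)
    exact ⟨Γ, hΓ, hmem⟩
  · obtain ⟨Msg, _, A, hA⟩ := h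
    obtain ⟨Γ, hΓ, hmem, -⟩ := A.exists_computable_decision ht val fun _ _ _ => hA _
    exact ⟨Γ, hΓ, hmem⟩
  · exact lt_of_unauthSolvable ht val hval h21 h
  · exact unauthSolvable_of_lt ht h.2 val h.1
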